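/- All vector spaces are complex and finite-dimensional. A \emph{quadratic Lie superalgebra} $(\mathfrak g,B)$ is a Lie superalgebra $\mathfrak g=\mathfrak g_{\bar 0}\oplus\mathfrak g_{\bar 1}$ with a non-degenerate bilinear form $B$ that is even ($B(\mathfrak g_{\bar 0},\mathfrak g_{\bar 1})=0$), supersymmetric ($B(X,Y)=(-1)^{xy}B(Y,X)$ for homogeneous $X,Y$ of parities $x,y$) and invariant ($B([X,Y],Z)=B(X,[Y,Z])$). Two such algebras are \emph{i-isomorphic} if there is an (even) isomorphism of Lie superalgebras between them that preserves the forms. $(\mathfrak g,B)$ is \emph{reduced} if $\mathfrak g\neq 0$ and its center is totally isotropic. Let $\mathscr E(\mathfrak g)=\operatorname{Alt}(\mathfrak g_{\bar 0})\otimes\operatorname{Sym}(\mathfrak g_{\bar 1})$ be the super-exterior algebra of $\mathfrak g^*$, identified with the algebra of super-antisymmetric multilinear forms on $\mathfrak g$, with product $\wedge$, and let $I(X,Y,Z)=B([X,Y],Z)$. $(\mathfrak g,B)$ is \emph{elementary} if $I$ is decomposable, i.e. $I=\alpha\wedge\beta\wedge\gamma$ for some $\alpha,\beta,\gamma\in\mathfrak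 g^*$. A non-Abelian $(\mathfrak g,B)$ is \emph{singular of type $\mathsf S_3$} if $\dim\{\alpha\in\mathfrak g^*\mid\alpha\wedge I=0\}=3$. \textbf{Proposition.} Every reduced elementary quadratic Lie superalgebra is i-isomorphic to exactly one member of the following list. (Brackets and values of $B$ that are not given, and do not follow by super-antisymmetry, respectively supersymmetry, are zero.) (1) Quadratic Lie algebras (zero odd part): \begin{itemize} \item $\mathfrak g_3(\lambda)$, $\lambda\in\mathbb C\setminus\{0\}$: the Lie algebra $\mathfrak o(3)$ with basis $e_1,e_2,e_3$, $[e_1,e_2]=e_3$, $[e_2,e_3]=e_1$, $[e_3,e_1]=e_2$, $B(e_i,e_i)=\lambda$; \item $\mathfrak g_4$: basis $X,P,Q,Z$, $[X,P]=P$, $[X,Q]=-Q$, $[P,Q]=Z$, $B(X,Z)=B(P,Q)=1$; \item $\mathfrak g_5$: basis $X_1,X_2,T,Z_1,Z_2$, $[X_1,X_2]=T$, $[X_1,T]=-Z_2$, $[X_2,T]=Z_1$, $B(X_1,Z_1)=B(X_2,Z_2)=B(T,T)=1$; \item $\mathfrak g_6$: basis $X_1,X_2,X_3,Z_1,Z_2,Z_3$,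 $[X_1,X_2]=Z_3$, $[X_2,X_3]=Z_1$, $[X_3,X_1]=Z_2$, $B(X_i,Z_i)=1$ for $i=1,2,3$. \end{itemize} (2) $\mathfrak g^s_{4,1}$: even basis $X_{\bar 0},Y_{\bar 0}$, odd basis $X_{\bar 1},Z_{\bar 1}$, $B(X_{\bar 0},Y_{\bar 0})=B(X_{\bar 1},Z_{\bar 1})=1$, $[Z_{\bar 1},Z_{\bar 1}]=-2X_{\bar 0}$, $[Y_{\bar 0},Z_{\bar 1}]=-2X_{\bar 1}$. (3) $\mathfrak g^s_{4,2}$: even basis $X_{\bar 0},Y_{\bar 0}$, odd basis $X_{\bar 1},Y_{\bar 1}$, $B(X_{\bar 0},Y_{\bar 0})=B(X_{\bar 1},Y_{\bar 1})=1$, $[X_{\bar 1},Y_{\bar 1}]=X_{\bar 0}$, $[Y_{\bar 0},X_{\bar 1}]=X_{\bar 1}$, $[Y_{\bar 0},Y_{\bar 1}]=-Y_{\bar 1}$. (4) $\mathfrak g^s_6$: even basis $X_{\bar 0},Y_{\bar 0}$, odd basis $X_{\bar 1},Y_{\bar 1},Z_{\bar 1},T_{\bar 1}$, $B(X_{\bar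 0},Y_{\bar 0})=B(X_{\bar 1},Z_{\bar 1})=B(Y_{\bar 1},T_{\bar 1})=1$, $[Z_{\bar 1},T_{\bar 1}]=-X_{\bar 0}$, $[Y_{\bar 0},Z_{\bar 1}]=-Y_{\bar 1}$, $[Y_{\bar 0},T_{\bar 1}]=-X_{\bar 1}$. Conversely, every member of the list is a reduced elementary quadratic Lie superalgebra; those in (1) are singular of type $\mathsf S_3$ with zero odd part, and those in (2)--(4) have a 2-dimensional even part. -/

import Mathlib

/-- The sign `(-1)^{ij}` attached to two parities `i, j ∈ ℤ/2ℤ`. -/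
def superSign (i j : ZMod 2) : ℤ := (-1) ^ (i.val * j.val)

/-- A complex Lie superalgebra structure on the vector space `V`: a `ℤ/2ℤ`-gradation
`V = V₀ ⊕ V₁` and an even bilinear super-bracket which is super-antisymmetric and satisfies the
super Jacobi identity. -/
structure LieSuperalgebra (V : Type*) [AddCommGroup V] [Module ℂ V] where
  /-- `part 0` is the even part and `part 1` is the odd part. -/
  part : ZMod 2 → Submodule ℂ V
  isCompl_part : IsCompl (part 0) (part 1)
  bracket : V →ₗ[ℂ] V →ₗ[ℂ] V
  bracket_mem : ∀ i j x y, x ∈ part i → y ∈ part j → bracket x y ∈ part (i + j)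
  bracket_skew : ∀ i j x y, x ∈ part i → y ∈ part j →
    bracket x y = -(superSign i j • bracket y x)
  jacobi : ∀ i j x y z, x ∈ part i → y ∈ part j →
    bracket x (bracket y z) = bracket (bracket x y) z + superSign i j • bracket y (bracket x z)

/-- A quadratic Lie superalgebra structure on `V`: a Lie superalgebra structure together with a
non-degenerate even supersymmetric invariant bilinear form. -/
structure QuadraticLieSuperalgebra (V : Type*) [AddCommGroup V] [Module ℂ V] extends
    LieSuperalgebra V where
  form : LinearMap.BilinForm ℂ V
  form_nondegenerate : form.Nondegenerate
  form_even : ∀ x y, x ∈ part 0 → y ∈ part 1 → form x y = 0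
  form_supersymm : ∀ i j x y, x ∈ part i → y ∈ part j → form x y = superSign i j • form y x
  form_invariant : ∀ x y z, form (bracket x y) z = form x (bracket y z)

namespace LieSuperalgebra

variable {V : Type*} [AddCommGroup V] [Module ℂ V]

/-- The centre. -/
def center (g : LieSuperalgebra V) : Submodule ℂ V := LinearMap.ker g.bracket

/-- The projection of `V` onto its even part, along the odd part. -/
noncomputable def evenProj (g : LieSuperalgebra V) : V →ₗ[ℂ] V :=
  Submodule.projection _ _ g.isCompl_part

/-- The projection of `V` onto its odd part, along the even part. -/
noncomputable def oddProj (g : LieSuperalgebra V) : V →ₗ[ℂ] V :=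
  Submodule.projection _ _ g.isCompl_part.symm

/-- The parity involution: the identity on the even part, minus the identity on the odd part. -/
noncomputable def parityInv (g : LieSuperalgebra V) : V →ₗ[ℂ] V := g.evenProj - g.oddProj

/-- The super-exterior product `α ∧ A` of a linear form and a `k`-linear form. The super-exterior
algebra of `V*` is realised as the algebra of super-antisymmetric multilinear forms. On homogeneous
vectors `X₀, …, X_k` of parities `x₀, …, x_k` the value is
`∑ⱼ (-1)^j (-1)^{xⱼ(x_{j+1} + ⋯ + x_k)} α(Xⱼ) A(X₀, …, X̂ⱼ, …, X_k)`.
The sign `(-1)^{xⱼ(x_{j+1} + ⋯ + x_k)}` appears only for the odd component of `Xⱼ`, and is there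
the effect of applying the parity involution to every `Xᵢ` with `i > j`. -/
noncomputable def wedge (g : LieSuperalgebra V) {k : ℕ} (α : Module.Dual ℂ V)
    (A : (Fin k → V) → ℂ) : (Fin (k + 1) → V) → ℂ := fun X =>
  ∑ j : Fin (k + 1), (-1) ^ (j : ℕ) *
    (α (g.evenProj (X j)) * A (fun i => X (j.succAbove i)) +
      α (g.oddProj (X j)) * A (fun i =>
        if j < j.succAbove i then g.parityInv (X (j.succAbove i)) else X (j.succAbove i)))

end LieSuperalgebra

namespace QuadraticLieSuperalgebra

variable {V : Type*} [AddCommGroup V] [Module ℂ V]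

/-- The associated invariant `I(X, Y, Z) = B([X, Y], Z)`. -/
def invariant (g : QuadraticLieSuperalgebra V) : (Fin 3 → V) → ℂ := fun X =>
  g.form (g.bracket (X 0) (X 1)) (X 2)

/-- `g` is elementary if its associated invariant is decomposable, that is, a super-exterior
product of three linear forms. -/
def IsElementary (g : QuadraticLieSuperalgebra V) : Prop :=
  ∃ α β γ : Module.Dual ℂ V,
    g.invariant = g.wedge α (g.wedge β (fun X : Fin 1 → V => γ (X 0)))

/-- `g` is reduced if it is nonzero and its centre is totally isotropic. -/
def IsReduced (g : QuadraticLieSuperalgebra V) : Prop :=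
  Nontrivial V ∧ ∀ x ∈ g.center, ∀ y ∈ g.center, g.form x y = 0

/-- The space of linear forms `α` with `α ∧ I = 0`. -/
noncomputable def dupSpace (g : QuadraticLieSuperalgebra V) : Submodule ℂ (Module.Dual ℂ V) where
  carrier := {α | g.wedge α g.invariant = 0}
  zero_mem' := by
    funext X
    simp [LieSuperalgebra.wedge]
  add_mem' := by
    intro α β hα hβ
    funext X
    have h : g.wedge (α + β) g.invariant X =
        g.wedge α g.invariant X + g.wedge β g.invariant X := by
      simp only [LieSuperalgebra.wedge, LinearMap.add_apply, ← Finset.sum_add_distrib]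
      exact Finset.sum_congr rfl fun j _ => by ring
    have hα' : g.wedge α g.invariant = 0 := hα
    have hβ' : g.wedge β g.invariant = 0 := hβ
    rw [h, hα', hβ']
    simp
  smul_mem' := by
    intro c α hα
    funext X
    have h : g.wedge (c • α) g.invariant X = c * g.wedge α g.invariant X := by
      simp only [LieSuperalgebra.wedge, LinearMap.smul_apply, smul_eq_mul, Finset.mul_sum]
      exact Finset.sum_congr rfl fun j _ => by ring
    have hα' : g.wedge α g.invariant = 0 := hα
    rw [h, hα']
    simp

/-- The dup-number. -/
noncomputable def dup (g : QuadraticLieSuperalgebra V) : ℕ := Module.finrank ℂ g.dupSpace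

/-- `g` is singular of type `S₃`: it is non-Abelian and its dup-number is `3`. -/
def IsSingularS3 (g : QuadraticLieSuperalgebra V) : Prop := g.bracket ≠ 0 ∧ g.dup = 3

/-- `g` and `h` are i-isomorphic: there is an isometric isomorphism of Lie superalgebras. -/
def IIsomorphic {W : Type*} [AddCommGroup W] [Module ℂ W]
    (g : QuadraticLieSuperalgebra V) (h : QuadraticLieSuperalgebra W) : Prop :=
  ∃ A : V ≃ₗ[ℂ] W,
    (∀ i, (g.part i).map A.toLinearMap = h.part i) ∧
    (∀ x y, A (g.bracket x y) = h.bracket (A x) (A y)) ∧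
    (∀ x y, h.form (A x) (A y) = g.form x y)

/-! ### Quadratic Lie superalgebras given by a table on the standard basis of `ℂⁿ` -/

section Table

variable {n : ℕ}

/-- The homogeneous components of `ℂⁿ` when the basis vector `e_a` has parity `p a`. -/
def tablePart (p : Fin n → ZMod 2) (i : ZMod 2) : Submodule ℂ (Fin n → ℂ) :=
  Submodule.span ℂ {x | ∃ a, p a = i ∧ x = Pi.single a 1}

/-- The coefficient of `e_k` in `[e_i, e_j]`. An entry `(a, b, m, v)` of the list `L` stands for
`[e_a, e_b] = v e_m`; brackets not determined by the list through super-antisymmetry are zero. -/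
def tableBracketCoeff (p : Fin n → ZMod 2) (L : List (Fin n × Fin n × Fin n × ℤ))
    (i j k : Fin n) : ℤ :=
  (L.map fun t =>
    if k = t.2.2.1 then
      if i = t.1 ∧ j = t.2.1 then t.2.2.2
      else if i = t.2.1 ∧ j = t.1 then -(superSign (p i) (p j) * t.2.2.2)
      else 0
    else 0).sum

/-- The value of `B(e_i, e_j)`. An entry `(a, b)` of the list `L` stands for `B(e_a, e_b) = 1`;
values not determined by the list through supersymmetry are zero. -/
def tableFormCoeff (p : Fin n → ZMod 2) (L : List (Fin n × Fin n)) (i j : Fin n) : ℤ :=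
  (L.map fun t =>
    if i = t.1 ∧ j = t.2 then 1
    else if i = t.2 ∧ j = t.1 then superSign (p i) (p j)
    else 0).sum

/-- The bilinear bracket on `ℂⁿ` with `[e_i, e_j] = ∑ₖ c i j k • e_k`. -/
def tableBracket (c : Fin n → Fin n → Fin n → ℤ) :
    (Fin n → ℂ) →ₗ[ℂ] (Fin n → ℂ) →ₗ[ℂ] (Fin n → ℂ) :=
  LinearMap.mk₂ ℂ (fun x y k => ∑ i, ∑ j, x i * y j * (c i j k : ℂ))
    (fun x x' y => by
      funext k
      simp only [Pi.add_apply, add_mul, Finset.sum_add_distrib])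
    (fun r x y => by
      funext k
      simp only [Pi.smul_apply, smul_eq_mul, Finset.mul_sum, mul_assoc])
    (fun x y y' => by
      funext k
      simp only [Pi.add_apply, add_mul, mul_add, Finset.sum_add_distrib])
    (fun r x y => by
      funext k
      simp only [Pi.smul_apply, smul_eq_mul, Finset.mul_sum]
      exact Finset.sum_congr rfl fun i _ => Finset.sum_congr rfl fun j _ => by ring)

/-- The bilinear form on `ℂⁿ` with `B(e_i, e_j) = r * b i j`. -/
def tableForm (r : ℂ) (b : Fin n → Fin n → ℤ) : LinearMap.BilinForm ℂ (Fin n → ℂ) :=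
  LinearMap.mk₂ ℂ (fun x y => ∑ i, ∑ j, x i * y j * (r * (b i j : ℂ)))
    (fun x x' y => by
      simp only [Pi.add_apply, add_mul, Finset.sum_add_distrib])
    (fun r x y => by
      simp only [Pi.smul_apply, smul_eq_mul, Finset.mul_sum, mul_assoc])
    (fun x y y' => by
      simp only [Pi.add_apply, add_mul, mul_add, Finset.sum_add_distrib])
    (fun r x y => by
      simp only [Pi.smul_apply, smul_eq_mul, Finset.mul_sum]
      exact Finset.sum_congr rfl fun i _ => Finset.sum_congr rfl fun j _ => by ring)

theorem tableBracket_single (c : Fin n → Fin n → Fin n → ℤ) (i j : Fin n) :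
    tableBracket c (Pi.single i 1) (Pi.single j 1) =
      ∑ k, (c i j k : ℂ) • (Pi.single k 1 : Fin n → ℂ) := by
  funext l
  simp [tableBracket, LinearMap.mk₂_apply, Pi.single_apply, Finset.sum_apply]

theorem tableForm_single (r : ℂ) (b : Fin n → Fin n → ℤ) (i j : Fin n) :
    tableForm r b (Pi.single i 1) (Pi.single j 1) = r * (b i j : ℂ) := by
  simp [tableForm, LinearMap.mk₂_apply, Pi.single_apply]

theorem tablePart_isCompl (p : Fin n → ZMod 2) : IsCompl (tablePart p 0) (tablePart p 1) := by
  have hz : ∀ i, ∀ x ∈ tablePart p i, ∀ k, p k ≠ i → x k = 0 := by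
    intro i x hx k hk
    induction hx using Submodule.span_induction with
    | mem x h =>
      obtain ⟨a, ha, rfl⟩ := h
      have : k ≠ a := by
        rintro rfl
        exact hk ha
      simp [this]
    | zero => rfl
    | add x y _ _ hx hy => simp [hx, hy]
    | smul r x _ hx => simp [hx]
  constructor
  · rw [Submodule.disjoint_def]
    intro x h0 h1
    funext k
    by_cases hk : p k = 0
    · exact hz 1 x h1 k (by rw [hk]; decide)
    · exact hz 0 x h0 k hk
  · rw [codisjoint_iff, eq_top_iff]
    intro x _
    have hx : x = ∑ a, x a • (Pi.single a 1 : Fin n → ℂ) := by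
      funext l
      simp [Finset.sum_apply, Pi.single_apply]
    rw [hx]
    refine Submodule.sum_mem _ fun a _ => Submodule.smul_mem _ _ ?_
    have h2 : ∀ q : ZMod 2, q = 0 ∨ q = 1 := by decide
    rcases h2 (p a) with h | h
    · exact Submodule.mem_sup_left (Submodule.subset_span ⟨a, h, rfl⟩)
    · exact Submodule.mem_sup_right (Submodule.subset_span ⟨a, h, rfl⟩)

theorem table_ext_span {p : Fin n → ZMod 2} {i : ZMod 2} {W : Type*} [AddCommGroup W]
    [Module ℂ W] {f h : (Fin n → ℂ) →ₗ[ℂ] W}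
    (H : ∀ a, p a = i → f (Pi.single a 1) = h (Pi.single a 1)) :
    ∀ x ∈ tablePart p i, f x = h x := by
  intro x hx
  induction hx using Submodule.span_induction with
  | mem x hx =>
    obtain ⟨a, ha, rfl⟩ := hx
    exact H a ha
  | zero => simp
  | add x y _ _ hx hy => simp [hx, hy]
  | smul r x _ hx => simp [hx]

theorem table_ext {W : Type*} [AddCommGroup W] [Module ℂ W] {f h : (Fin n → ℂ) →ₗ[ℂ] W}
    (H : ∀ a, f (Pi.single a 1) = h (Pi.single a 1)) : f = h :=
  (Pi.basisFun ℂ (Fin n)).ext fun a => by simpa using H a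

/-- The finitely many identities which make a table a quadratic Lie superalgebra. -/
structure TableLaws (p : Fin n → ZMod 2) (c : Fin n → Fin n → Fin n → ℤ)
    (b : Fin n → Fin n → ℤ) : Prop where
  even : ∀ i j k, c i j k ≠ 0 → p k = p i + p j
  skew : ∀ i j k, c i j k = -(superSign (p i) (p j) * c j i k)
  jacobi : ∀ i j k l, ∑ m, c j k m * c i m l =
    ∑ m, c i j m * c m k l + superSign (p i) (p j) * ∑ m, c i k m * c j m l
  form_even : ∀ i j, b i j ≠ 0 → p i = p j
  form_symm : ∀ i j, b i j = superSign (p i) (p j) * b j i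
  invariant : ∀ i j k, ∑ m, c i j m * b m k = ∑ m, c j k m * b i m
  orthogonal : ∀ i j, ∑ m, b m i * b m j = if i = j then 1 else 0

/-- The quadratic Lie superalgebra on `ℂⁿ` with `[e_i, e_j] = ∑ₖ c i j k • e_k` and
`B(e_i, e_j) = r * b i j`, where `e_a` has parity `p a`. -/
def ofTable (p : Fin n → ZMod 2) (c : Fin n → Fin n → Fin n → ℤ) (r : ℂˣ)
    (b : Fin n → Fin n → ℤ) (H : TableLaws p c b) : QuadraticLieSuperalgebra (Fin n → ℂ) where
  part := tablePart p
  isCompl_part := tablePart_isCompl p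
  bracket := tableBracket c
  bracket_mem := by
    intro i j x y hx hy
    have key : ∀ a, p a = i → ∀ y ∈ tablePart p j,
        tableBracket c (Pi.single a 1) y ∈ tablePart p (i + j) := by
      intro a ha y hy
      induction hy using Submodule.span_induction with
      | mem y h =>
        obtain ⟨b', hb, rfl⟩ := h
        rw [tableBracket_single]
        refine Submodule.sum_mem _ fun k _ => ?_
        by_cases hk : c a b' k = 0
        · simp [hk]
        · refine Submodule.smul_mem _ _ (Submodule.subset_span ⟨k, ?_, rfl⟩)
          rw [H.even a b' k hk, ha, hb]
      | zero => simp
      | add x y _ _ hx hy =>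
        rw [map_add]
        exact add_mem hx hy
      | smul r x _ hx =>
        rw [map_smul]
        exact Submodule.smul_mem _ _ hx
    induction hx using Submodule.span_induction with
    | mem x h =>
      obtain ⟨a, ha, rfl⟩ := h
      exact key a ha y hy
    | zero => simp
    | add x y _ _ hx hy =>
      rw [map_add, LinearMap.add_apply]
      exact add_mem hx hy
    | smul r x _ hx =>
      rw [map_smul, LinearMap.smul_apply]
      exact Submodule.smul_mem _ _ hx
  bracket_skew := by
    intro i j x y hx hy
    refine table_ext_span (f := (tableBracket c).flip y)
      (h := -(superSign i j • tableBracket c y)) (fun a ha => ?_) x hx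
    refine table_ext_span (f := tableBracket c (Pi.single a 1))
      (h := -(superSign i j • (tableBracket c).flip (Pi.single a 1))) (fun d hd => ?_) y hy
    simp only [LinearMap.neg_apply, LinearMap.smul_apply, LinearMap.flip_apply,
      tableBracket_single, Finset.smul_sum, ← Finset.sum_neg_distrib]
    refine Finset.sum_congr rfl fun k _ => ?_
    rw [H.skew a d k, ha, hd, ← Int.cast_smul_eq_zsmul ℂ, smul_smul, ← neg_smul]
    push_cast
    rfl
  jacobi := by
    intro i j x y z hx hy
    refine table_ext_span
      (f := (tableBracket c).flip (tableBracket c y z))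
      (h := (tableBracket c).flip z ∘ₗ (tableBracket c).flip y +
        superSign i j • (tableBracket c y ∘ₗ (tableBracket c).flip z)) (fun a ha => ?_) x hx
    refine table_ext_span
      (f := tableBracket c (Pi.single a 1) ∘ₗ (tableBracket c).flip z)
      (h := (tableBracket c).flip z ∘ₗ tableBracket c (Pi.single a 1) +
        superSign i j • (tableBracket c).flip (tableBracket c (Pi.single a 1) z))
      (fun d hd => ?_) y hy
    refine LinearMap.congr_fun (f := tableBracket c (Pi.single a 1) ∘ₗ
        tableBracket c (Pi.single d 1))
      (g := tableBracket c (tableBracket c (Pi.single a 1) (Pi.single d 1)) +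
        superSign i j • (tableBracket c (Pi.single d 1) ∘ₗ tableBracket c (Pi.single a 1)))
      (table_ext fun e => ?_) z
    funext l
    have hJ := congrArg (Int.cast : ℤ → ℂ) (H.jacobi a d e l)
    rw [ha, hd] at hJ
    push_cast at hJ
    simp [tableBracket_single, map_sum, LinearMap.sum_apply, Finset.sum_apply,
      Pi.single_apply, hJ, Finset.mul_sum]
    exact Finset.sum_congr rfl fun k _ => by ring
  form := tableForm r b
  form_nondegenerate := by
    have hs : ∀ i k, ∑ m, b m i * b m k = if i = k then 1 else 0 := H.orthogonal
    have hs' : ∀ i k, ∑ m, ((b m i : ℤ) : ℂ) * (b m k : ℂ) = if i = k then 1 else 0 := by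
      intro i k
      exact_mod_cast congrArg (Int.cast : ℤ → ℂ) (hs i k)
    have hM : (Matrix.of fun i j => ((b i j : ℤ) : ℂ)).transpose *
        (Matrix.of fun i j => ((b i j : ℤ) : ℂ)) = 1 := by
      ext i k
      simp [Matrix.mul_apply, Matrix.one_apply, hs']
    have hM' := mul_eq_one_comm.mp hM
    have hs2 : ∀ i k, ∑ m, ((b i m : ℤ) : ℂ) * (b k m : ℂ) = if i = k then 1 else 0 := by
      intro i k
      have := congrFun (congrFun hM' i) k
      simpa [Matrix.mul_apply, Matrix.one_apply] using this
    refine ⟨fun x hx => ?_, fun y hy => ?_⟩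
    · funext k
      have h := hx (fun j => (b k j : ℂ))
      have e : tableForm (r : ℂ) b x (fun j => (b k j : ℂ)) = r * x k := by
        have : ∀ i, ∑ j, x i * (b k j : ℂ) * (r * (b i j : ℂ)) =
            r * x i * ∑ j, (b i j : ℂ) * (b k j : ℂ) := by
          intro i
          rw [Finset.mul_sum]
          exact Finset.sum_congr rfl fun j _ => by ring
        simp [tableForm, LinearMap.mk₂_apply, this, hs2]
      rw [e] at h
      simpa using h
    · funext k
      have h := hy (fun j => (b j k : ℂ))
      have e : tableForm (r : ℂ) b (fun j => (b j k : ℂ)) y = r * y k := by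
        have : ∀ j, ∑ i, (b i k : ℂ) * y j * (r * (b i j : ℂ)) =
            r * y j * ∑ i, (b i k : ℂ) * (b i j : ℂ) := by
          intro j
          rw [Finset.mul_sum]
          exact Finset.sum_congr rfl fun i _ => by ring
        simp only [tableForm, LinearMap.mk₂_apply]
        rw [Finset.sum_comm]
        simp [this, hs']
      rw [e] at h
      simpa using h
  form_even := by
    intro x y hx hy
    refine table_ext_span (f := (tableForm (r : ℂ) b).flip y) (h := 0) (fun a ha => ?_) x hx
    refine table_ext_span (f := tableForm (r : ℂ) b (Pi.single a 1)) (h := 0)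
      (fun d hd => ?_) y hy
    have : b a d = 0 := by
      by_contra h
      have := H.form_even a d h
      rw [ha, hd] at this
      exact absurd this (by decide)
    simp [tableForm_single, this]
  form_supersymm := by
    intro i j x y hx hy
    refine table_ext_span (f := (tableForm (r : ℂ) b).flip y)
      (h := superSign i j • tableForm (r : ℂ) b y) (fun a ha => ?_) x hx
    refine table_ext_span (f := tableForm (r : ℂ) b (Pi.single a 1))
      (h := superSign i j • (tableForm (r : ℂ) b).flip (Pi.single a 1)) (fun d hd => ?_) y hy
    change tableForm (r : ℂ) b (Pi.single a 1) (Pi.single d 1) =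
      superSign i j • tableForm (r : ℂ) b (Pi.single d 1) (Pi.single a 1)
    rw [tableForm_single, tableForm_single, H.form_symm a d, ha, hd, zsmul_eq_mul]
    push_cast
    ring
  form_invariant := by
    intro x y z
    refine LinearMap.congr_fun (f := (tableForm (r : ℂ) b).flip z ∘ₗ (tableBracket c).flip y)
      (g := (tableForm (r : ℂ) b).flip (tableBracket c y z)) (table_ext fun a => ?_) x
    refine LinearMap.congr_fun
      (f := (tableForm (r : ℂ) b).flip z ∘ₗ tableBracket c (Pi.single a 1))
      (g := tableForm (r : ℂ) b (Pi.single a 1) ∘ₗ (tableBracket c).flip z)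
      (table_ext fun d => ?_) y
    refine LinearMap.congr_fun
      (f := tableForm (r : ℂ) b (tableBracket c (Pi.single a 1) (Pi.single d 1)))
      (g := tableForm (r : ℂ) b (Pi.single a 1) ∘ₗ tableBracket c (Pi.single d 1))
      (table_ext fun e => ?_) z
    have hI := congrArg (fun t : ℤ => (r : ℂ) * (t : ℂ)) (H.invariant a d e)
    push_cast at hI
    simp only [LinearMap.comp_apply, tableBracket_single, map_sum, map_smul,
      LinearMap.sum_apply, LinearMap.smul_apply, tableForm_single, smul_eq_mul]
    simp only [Finset.mul_sum] at hI
    rw [Finset.sum_congr rfl fun k _ => mul_left_comm _ _ _, hI]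
    exact Finset.sum_congr rfl fun k _ => mul_left_comm _ _ _

end Table

/-- `o(3)`, even, with basis `e₀, e₁, e₂`: `[e₀, e₁] = e₂`, `[e₁, e₂] = e₀`, `[e₂, e₀] = e₁`
and `B(e_a, e_a) = r` for a nonzero scalar `r` (so `B` is `-r/2` times the Killing form). -/
def g3 (r : ℂˣ) : QuadraticLieSuperalgebra (Fin 3 → ℂ) :=
  ofTable ![0, 0, 0]
    (tableBracketCoeff ![0, 0, 0] [(0, 1, 2, 1), (1, 2, 0, 1), (2, 0, 1, 1)]) r
    (tableFormCoeff ![0, 0, 0] [(0, 0), (1, 1), (2, 2)])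
    (by constructor <;> decide +kernel)

/-- The even algebra with basis `X, P, Q, Z`: `[X, P] = P`, `[X, Q] = -Q`, `[P, Q] = Z` and
`B(X, Z) = B(P, Q) = 1`. -/
def g4 : QuadraticLieSuperalgebra (Fin 4 → ℂ) :=
  ofTable ![0, 0, 0, 0]
    (tableBracketCoeff ![0, 0, 0, 0] [(0, 1, 1, 1), (0, 2, 2, -1), (1, 2, 3, 1)]) 1
    (tableFormCoeff ![0, 0, 0, 0] [(0, 3), (1, 2)])
    (by constructor <;> decide +kernel)

/-- The even algebra with basis `X₁, X₂, T, Z₁, Z₂`: `[X₁, X₂] = T`, `[X₁, T] = -Z₂`,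
`[X₂, T] = Z₁` and `B(X₁, Z₁) = B(X₂, Z₂) = B(T, T) = 1`. -/
def g5 : QuadraticLieSuperalgebra (Fin 5 → ℂ) :=
  ofTable ![0, 0, 0, 0, 0]
    (tableBracketCoeff ![0, 0, 0, 0, 0] [(0, 1, 2, 1), (0, 2, 4, -1), (1, 2, 3, 1)]) 1
    (tableFormCoeff ![0, 0, 0, 0, 0] [(0, 3), (1, 4), (2, 2)])
    (by constructor <;> decide +kernel)

/-- The even algebra with basis `X₁, X₂, X₃, Z₁, Z₂, Z₃`: `[X₁, X₂] = Z₃`, `[X₂, X₃] = Z₁`,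
`[X₃, X₁] = Z₂` and `B(X₁, Z₁) = B(X₂, Z₂) = B(X₃, Z₃) = 1`. -/
def g6 : QuadraticLieSuperalgebra (Fin 6 → ℂ) :=
  ofTable ![0, 0, 0, 0, 0, 0]
    (tableBracketCoeff ![0, 0, 0, 0, 0, 0] [(0, 1, 5, 1), (1, 2, 3, 1), (2, 0, 4, 1)]) 1
    (tableFormCoeff ![0, 0, 0, 0, 0, 0] [(0, 3), (1, 4), (2, 5)])
    (by constructor <;> decide +kernel)

/-- Even basis vectors `X₀, Y₀`, odd basis vectors `X₁, Z₁`; `[Z₁, Z₁] = -2 X₀`,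
`[Y₀, Z₁] = -2 X₁` and `B(X₀, Y₀) = B(X₁, Z₁) = 1`. -/
def gs41 : QuadraticLieSuperalgebra (Fin 4 → ℂ) :=
  ofTable ![0, 0, 1, 1]
    (tableBracketCoeff ![0, 0, 1, 1] [(3, 3, 0, -2), (1, 3, 2, -2)]) 1
    (tableFormCoeff ![0, 0, 1, 1] [(0, 1), (2, 3)])
    (by constructor <;> decide +kernel)

/-- Even basis vectors `X₀, Y₀`, odd basis vectors `X₁, Y₁`; `[X₁, Y₁] = X₀`,
`[Y₀, X₁] = X₁`, `[Y₀, Y₁] = -Y₁` and `B(X₀, Y₀) = B(X₁, Y₁) = 1`. -/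
def gs42 : QuadraticLieSuperalgebra (Fin 4 → ℂ) :=
  ofTable ![0, 0, 1, 1]
    (tableBracketCoeff ![0, 0, 1, 1] [(2, 3, 0, 1), (1, 2, 2, 1), (1, 3, 3, -1)]) 1
    (tableFormCoeff ![0, 0, 1, 1] [(0, 1), (2, 3)])
    (by constructor <;> decide +kernel)

/-- Even basis vectors `X₀, Y₀`, odd basis vectors `X₁, Y₁, Z₁, T₁`; `[Z₁, T₁] = -X₀`,
`[Y₀, Z₁] = -Y₁`, `[Y₀, T₁] = -X₁` and `B(X₀, Y₀) = B(X₁, Z₁) = B(Y₁, T₁) = 1`. -/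
def gs6 : QuadraticLieSuperalgebra (Fin 6 → ℂ) :=
  ofTable ![0, 0, 1, 1, 1, 1]
    (tableBracketCoeff ![0, 0, 1, 1, 1, 1] [(4, 5, 0, -1), (1, 4, 3, -1), (1, 5, 2, -1)]) 1
    (tableFormCoeff ![0, 0, 1, 1, 1, 1] [(0, 1), (2, 4), (3, 5)])
    (by constructor <;> decide +kernel)

/-- The members of the list of quadratic Lie algebras of type `S₃`. -/
inductive LieModel
  | g3 (r : ℂˣ)
  | g4
  | g5
  | g6

/-- The members of the list of quadratic Lie superalgebras with nonzero odd part. -/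
inductive SuperModel
  | gs41
  | gs42
  | gs6

def LieModel.dim : LieModel → ℕ
  | .g3 _ => 3
  | .g4 => 4
  | .g5 => 5
  | .g6 => 6

def LieModel.algebra : (m : LieModel) → QuadraticLieSuperalgebra (Fin m.dim → ℂ)
  | .g3 r => QuadraticLieSuperalgebra.g3 r
  | .g4 => QuadraticLieSuperalgebra.g4
  | .g5 => QuadraticLieSuperalgebra.g5
  | .g6 => QuadraticLieSuperalgebra.g6

def SuperModel.dim : SuperModel → ℕ
  | .gs41 => 4
  | .gs42 => 4
  | .gs6 => 6

def SuperModel.algebra : (m : SuperModel) → QuadraticLieSuperalgebra (Fin m.dim → ℂ)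
  | .gs41 => QuadraticLieSuperalgebra.gs41
  | .gs42 => QuadraticLieSuperalgebra.gs42
  | .gs6 => QuadraticLieSuperalgebra.gs6

/-- `g` is i-isomorphic to the given member of the full list. -/
def IsModelledBy {V : Type*} [AddCommGroup V] [Module ℂ V] (g : QuadraticLieSuperalgebra V) :
    LieModel ⊕ SuperModel → Prop
  | .inl m => g.IIsomorphic m.algebra
  | .inr m => g.IIsomorphic m.algebra

end QuadraticLieSuperalgebra

/-! By non-degeneracy the bracket is determined by `B` and the invariant `I`. If `I` is a product of
linear forms `B(u, ·)`, `B(v, ·)`, `B(w, ·)`, then for a reduced algebra everything depends on the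
pairings among `u, v, w` and on one scalar.

The factors can be taken homogeneous (`IsElementary.homogeneous`). Since `I` is even, its component
on three odd vectors vanishes; that component is the product of the odd parts of the factors, so one
odd part is zero. The vanishing on two even vectors and one odd vector then leaves only two shapes:
three even factors, or one even and two odd factors.

Reducedness bounds the size. A vector killed by all three factors is central, and the centre is
isotropic, so the centre lies in the span of `u, v, w` (`IsReduced.center_le_span`). Hence a
homogeneous family with non-degenerate Gram matrix whose span contains `u, v, w` is already a basis:
a vector orthogonal to the family is central, hence in its span. Recognising a model thus amounts to
completing `u, v, w` to a frame with the right table (`IsReduced.iIsomorphic_ofTable`).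

With three even factors the odd part is central, hence zero. The Gram form of `u, v, w` is
diagonalised over `ℂ`; ranks 3, 2, 1, 0 give `g3`, `g4`, `g5`, `g6`. The leftover scalar can be
absorbed into an isotropic factor, except in rank 3, where it becomes the parameter of `g3`.

With an even factor `a` and odd factors `b, c`, the Jacobi identity forces `B(a, a) = 0`. Then `B(b,
c) ≠ 0` gives `gs42`; `B(b, c) = 0` gives `gs41` if `b, c` are proportional and `gs6` otherwise.

The models are separated by dimension and by the presence of an odd part, `gs41` and `gs42` by
two-step nilpotency, and the algebras `g3` by an identity for double brackets. Their stated
properties reduce to finite checks on structure constants. -/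

/-- The value on `x, y, z` of the exterior product of three linear forms. -/
def det3 {V : Type*} (α β γ : V → ℂ) (x y z : V) : ℂ :=
  α x * (β y * γ z - β z * γ y) - α y * (β x * γ z - β z * γ x) + α z * (β x * γ y - β y * γ x)

/-- The value on `x, y, z` of the super-exterior product of an even linear form `α` with the
symmetric product of two odd linear forms `β` and `γ`, up to sign. -/
def ssym3 {V : Type*} (α β γ : V → ℂ) (x y z : V) : ℂ :=
  α x * (β y * γ z + β z * γ y) - α y * (β x * γ z + β z * γ x) + α z * (β x * γ y + β y * γ x)

@[simp]
theorem superSign_zero_left (i : ZMod 2) : superSign 0 i = 1 := by simp [superSign]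

@[simp]
theorem superSign_one_one : superSign 1 1 = -1 := by decide

/-! ### Parity components and the triple super-exterior product. -/

namespace LieSuperalgebra

variable {V : Type*} [AddCommGroup V] [Module ℂ V] (g : LieSuperalgebra V)

theorem evenProj_mem (x : V) : g.evenProj x ∈ g.part 0 :=
  Submodule.projection_apply_mem _ x

theorem oddProj_mem (x : V) : g.oddProj x ∈ g.part 1 :=
  Submodule.projection_apply_mem _ x

theorem evenProj_add_oddProj (x : V) : g.evenProj x + g.oddProj x = x :=
  Submodule.projection_add_projection_eq_self _ x

theorem evenProj_of_mem_even {x : V} (hx : x ∈ g.part 0) : g.evenProj x = x :=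
  (Submodule.projection_eq_self_iff _ x).2 hx

theorem evenProj_of_mem_odd {x : V} (hx : x ∈ g.part 1) : g.evenProj x = 0 :=
  (Submodule.projection_apply_eq_zero_iff _).2 hx

theorem oddProj_of_mem_odd {x : V} (hx : x ∈ g.part 1) : g.oddProj x = x :=
  (Submodule.projection_eq_self_iff _ x).2 hx

theorem oddProj_of_mem_even {x : V} (hx : x ∈ g.part 0) : g.oddProj x = 0 :=
  (Submodule.projection_apply_eq_zero_iff _).2 hx

@[simp]
theorem evenProj_evenProj (x : V) : g.evenProj (g.evenProj x) = g.evenProj x :=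
  g.evenProj_of_mem_even (g.evenProj_mem x)

@[simp]
theorem evenProj_oddProj (x : V) : g.evenProj (g.oddProj x) = 0 :=
  g.evenProj_of_mem_odd (g.oddProj_mem x)

@[simp]
theorem oddProj_oddProj (x : V) : g.oddProj (g.oddProj x) = g.oddProj x :=
  g.oddProj_of_mem_odd (g.oddProj_mem x)

@[simp]
theorem oddProj_evenProj (x : V) : g.oddProj (g.evenProj x) = 0 :=
  g.oddProj_of_mem_even (g.evenProj_mem x)

theorem apply_eq_evenProj_add_oddProj {M : Type*} [AddCommGroup M] [Module ℂ M] (f : V →ₗ[ℂ] M)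
    (x : V) : f x = f (g.evenProj x) + f (g.oddProj x) := by
  rw [← map_add, g.evenProj_add_oddProj]

/-- The super-exterior product of three linear forms, in terms of their components. -/
theorem wedge_wedge_apply (α β γ : Module.Dual ℂ V) (x y z : V) :
    g.wedge α (g.wedge β (fun X : Fin 1 → V => γ (X 0))) ![x, y, z] =
      (let p := g.evenProj; let q := g.oddProj
      α (p x) * (β (p y) * (γ (p z) + γ (q z)) + β (q y) * (γ (p z) - γ (q z))
          - (β (p z) + β (q z)) * (γ (p y) + γ (q y)))
        + α (q x) * (β (p y) * (γ (p z) - γ (q z)) - β (q y) * (γ (p z) + γ (q z))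
          - (β (p z) - β (q z)) * (γ (p y) - γ (q y)))
        - α (p y) * (β (p x) * (γ (p z) + γ (q z)) + β (q x) * (γ (p z) - γ (q z))
          - (β (p z) + β (q z)) * (γ (p x) + γ (q x)))
        - α (q y) * (β (p x) * (γ (p z) - γ (q z)) + β (q x) * (γ (p z) + γ (q z))
          - (β (p z) - β (q z)) * (γ (p x) + γ (q x)))
        + (α (p z) + α (q z)) * (β (p x) * (γ (p y) + γ (q y)) + β (q x) * (γ (p y) - γ (q y))
          - (β (p y) + β (q y)) * (γ (p x) + γ (q x)))) := by
  -- In the twofold product a sign arises only when an odd component moves past a vector to its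
  -- right, so the parity involution meets `Y 1` in the first term and nothing in the second.
  have key : ∀ Y : Fin 2 → V, g.wedge β (fun X : Fin 1 → V => γ (X 0)) Y =
      β (g.evenProj (Y 0)) * γ (Y 1) + β (g.oddProj (Y 0)) * γ (g.parityInv (Y 1))
        - β (Y 1) * γ (Y 0) := by
    intro Y
    rw [g.apply_eq_evenProj_add_oddProj β (Y 1)]
    simp [wedge, Fin.sum_univ_two, Fin.succAbove]
    ring
  have e1 : ∀ δ : Module.Dual ℂ V, ∀ v, δ v = δ (g.evenProj v) + δ (g.oddProj v) :=
    fun δ v => g.apply_eq_evenProj_add_oddProj δ v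
  have e2 : ∀ v, g.evenProj (g.parityInv v) = g.evenProj v := by intro v; simp [parityInv]
  have e3 : ∀ v, g.oddProj (g.parityInv v) = -g.oddProj v := by intro v; simp [parityInv]
  have e4 : ∀ δ : Module.Dual ℂ V, ∀ v,
      δ (g.parityInv v) = δ (g.evenProj v) - δ (g.oddProj v) := by intro δ v; simp [parityInv]
  rw [wedge, Fin.sum_univ_three]
  simp only [key]
  simp [Fin.succAbove, e2, e3, e4]
  rw [e1 β y, e1 β z, e1 γ x, e1 γ y, e1 γ z]
  ring

end LieSuperalgebra

/-! ### Parity rules for the form and the invariant; homogeneous factors. -/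

namespace QuadraticLieSuperalgebra

variable {V : Type*} [AddCommGroup V] [Module ℂ V] (g : QuadraticLieSuperalgebra V)

theorem eq_zero_of_form_eq_zero {x : V} (h : ∀ y, g.form x y = 0) : x = 0 :=
  g.form_nondegenerate.1 x h

theorem eq_of_form_eq {x x' : V} (h : ∀ y, g.form x y = g.form x' y) : x = x' :=
  sub_eq_zero.1 (g.eq_zero_of_form_eq_zero fun y => by simp [h])

theorem form_odd_even {x y : V} (hx : x ∈ g.part 1) (hy : y ∈ g.part 0) : g.form x y = 0 := by
  rw [g.form_supersymm 1 0 x y hx hy, g.form_even y x hy hx, smul_zero]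

theorem form_comm_even {x y : V} (hx : x ∈ g.part 0) (hy : y ∈ g.part 0) :
    g.form x y = g.form y x := by
  simpa using g.form_supersymm 0 0 x y hx hy

theorem form_comm_odd {x y : V} (hx : x ∈ g.part 1) (hy : y ∈ g.part 1) :
    g.form x y = -g.form y x := by
  simpa using g.form_supersymm 1 1 x y hx hy

theorem form_self_odd {x : V} (hx : x ∈ g.part 1) : g.form x x = 0 :=
  self_eq_neg.1 (g.form_comm_odd hx hx)

theorem form_comm_even_left {x : V} (hx : x ∈ g.part 0) (y : V) : g.form x y = g.form y x := by
  rw [← g.evenProj_add_oddProj y, map_add, map_add, LinearMap.add_apply,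
    g.form_even x _ hx (g.oddProj_mem y), g.form_odd_even (g.oddProj_mem y) hx,
    g.form_comm_even hx (g.evenProj_mem y)]

theorem form_comm_odd_left {x : V} (hx : x ∈ g.part 1) (y : V) : g.form x y = -g.form y x := by
  rw [← g.evenProj_add_oddProj y, map_add, map_add, LinearMap.add_apply,
    g.form_odd_even hx (g.evenProj_mem y), g.form_even _ x (g.evenProj_mem y) hx,
    g.form_comm_odd hx (g.oddProj_mem y), zero_add, zero_add]

/-- A linear form `B(a, ·)` vanishing on the odd part is represented by an even vector. -/
theorem mem_even_of_form_eq_zero {a : V} (h : ∀ x ∈ g.part 1, g.form a x = 0) : a ∈ g.part 0 := by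
  have h0 : g.oddProj a = 0 := by
    refine g.eq_zero_of_form_eq_zero fun y => ?_
    rw [g.apply_eq_evenProj_add_oddProj (g.form (g.oddProj a)) y,
      g.form_odd_even (g.oddProj_mem a) (g.evenProj_mem y), zero_add]
    have := h _ (g.oddProj_mem y)
    rwa [← g.evenProj_add_oddProj a, map_add, LinearMap.add_apply,
      g.form_even _ _ (g.evenProj_mem a) (g.oddProj_mem y), zero_add] at this
  rw [← g.evenProj_add_oddProj a, h0, add_zero]
  exact g.evenProj_mem a

/-- A linear form `B(a, ·)` vanishing on the even part is represented by an odd vector. -/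
theorem mem_odd_of_form_eq_zero {a : V} (h : ∀ x ∈ g.part 0, g.form a x = 0) : a ∈ g.part 1 := by
  have h0 : g.evenProj a = 0 := by
    refine g.eq_zero_of_form_eq_zero fun y => ?_
    rw [g.apply_eq_evenProj_add_oddProj (g.form (g.evenProj a)) y,
      g.form_even _ _ (g.evenProj_mem a) (g.oddProj_mem y), add_zero]
    have := h _ (g.evenProj_mem y)
    rwa [← g.evenProj_add_oddProj a, map_add, LinearMap.add_apply,
      g.form_odd_even (g.oddProj_mem a) (g.evenProj_mem y), add_zero] at this
  rw [← g.evenProj_add_oddProj a, h0, zero_add]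
  exact g.oddProj_mem a

theorem mem_center_of_form_bracket_eq_zero {x : V}
    (h : ∀ y z, g.form (g.bracket x y) z = 0) : x ∈ g.center :=
  LinearMap.mem_ker.2 <| LinearMap.ext fun y => g.eq_zero_of_form_eq_zero (h y)

theorem invariant_apply (x y z : V) : g.invariant ![x, y, z] = g.form (g.bracket x y) z := rfl

theorem form_bracket_eq_zero {i j k : ZMod 2} (h : i + j + k = 1) {x y z : V} (hx : x ∈ g.part i)
    (hy : y ∈ g.part j) (hz : z ∈ g.part k) : g.form (g.bracket x y) z = 0 := by
  have hm := g.bracket_mem i j x y hx hy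
  have h2 : ∀ q : ZMod 2, q = 0 ∨ q = 1 := by decide
  rcases h2 (i + j) with h0 | h0 <;> rcases h2 k with h1 | h1 <;> rw [h0] at hm h <;>
    rw [h1] at hz h
  · exact absurd h (by decide)
  · exact g.form_even _ _ hm hz
  · exact g.form_odd_even hm hz
  · exact absurd h (by decide)

/-- The invariant is the sum of its values on the homogeneous components of even total parity. -/
theorem form_bracket_eq_sum (x y z : V) : g.form (g.bracket x y) z =
    g.form (g.bracket (g.evenProj x) (g.evenProj y)) (g.evenProj z) +
    g.form (g.bracket (g.evenProj x) (g.oddProj y)) (g.oddProj z) +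
    g.form (g.bracket (g.oddProj x) (g.evenProj y)) (g.oddProj z) +
    g.form (g.bracket (g.oddProj x) (g.oddProj y)) (g.evenProj z) := by
  have e := g.evenProj_mem
  have o := g.oddProj_mem
  conv_lhs => rw [← g.evenProj_add_oddProj x, ← g.evenProj_add_oddProj y,
    ← g.evenProj_add_oddProj z]
  simp only [map_add, LinearMap.add_apply]
  rw [g.form_bracket_eq_zero (by decide) (e x) (e y) (o z),
    g.form_bracket_eq_zero (by decide) (e x) (o y) (e z),
    g.form_bracket_eq_zero (by decide) (o x) (e y) (e z),
    g.form_bracket_eq_zero (by decide) (o x) (o y) (o z)]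
  ring

/-- If a product of three linear forms vanishes, then one of the forms does. -/
theorem eq_zero_of_mul_mul_eq_zero {α β γ : Module.Dual ℂ V} (h : ∀ x, α x * β x * γ x = 0) :
    α = 0 ∨ β = 0 ∨ γ = 0 := by
  by_contra! hne
  obtain ⟨hα, hβ, hγ⟩ := hne
  -- Over an infinite field, finitely many nonzero linear forms are simultaneously nonzero at some
  -- vector.
  obtain ⟨x, hx⟩ := Module.Dual.exists_forall_ne_zero_of_forall_exists ![α, β, γ] (by
    intro i
    fin_cases i
    · exact DFunLike.ne_iff.1 hα
    · exact DFunLike.ne_iff.1 hβ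
    · exact DFunLike.ne_iff.1 hγ)
  exact mul_ne_zero (mul_ne_zero (hx 0) (hx 1)) (hx 2) (h x)

/-- The decomposable invariant of an elementary algebra is a product of homogeneous linear forms. -/
theorem IsElementary.homogeneous {g : QuadraticLieSuperalgebra V} (hg : g.IsElementary) :
    (∃ α β γ : Module.Dual ℂ V, (∀ x ∈ g.part 1, α x = 0 ∧ β x = 0 ∧ γ x = 0) ∧
      ∀ x y z, g.form (g.bracket x y) z = det3 α β γ x y z) ∨
    (∃ α β γ : Module.Dual ℂ V, (∀ x ∈ g.part 1, α x = 0) ∧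
      (∀ x ∈ g.part 0, β x = 0 ∧ γ x = 0) ∧
      ∀ x y z, g.form (g.bracket x y) z = ssym3 α β γ x y z) := by
  obtain ⟨α, β, γ, h⟩ := hg
  set a := α ∘ₗ g.evenProj with ha
  set b := β ∘ₗ g.evenProj with hb
  set c := γ ∘ₗ g.evenProj with hc
  set a' := α ∘ₗ g.oddProj with ha'
  set b' := β ∘ₗ g.oddProj with hb'
  set c' := γ ∘ₗ g.oddProj with hc'
  have a1 : ∀ x ∈ g.part 1, a x = 0 := fun x hx => by simp [ha, g.evenProj_of_mem_odd hx]
  have b1 : ∀ x ∈ g.part 1, b x = 0 := fun x hx => by simp [hb, g.evenProj_of_mem_odd hx]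
  have c1 : ∀ x ∈ g.part 1, c x = 0 := fun x hx => by simp [hc, g.evenProj_of_mem_odd hx]
  have a0 : ∀ x ∈ g.part 0, a' x = 0 := fun x hx => by simp [ha', g.oddProj_of_mem_even hx]
  have b0 : ∀ x ∈ g.part 0, b' x = 0 := fun x hx => by simp [hb', g.oddProj_of_mem_even hx]
  have c0 : ∀ x ∈ g.part 0, c' x = 0 := fun x hx => by simp [hc', g.oddProj_of_mem_even hx]
  have hI : ∀ x y z, g.form (g.bracket x y) z =
      g.wedge α (g.wedge β (fun X : Fin 1 → V => γ (X 0))) ![x, y, z] :=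
    fun x y z => congrFun h ![x, y, z]
  simp only [g.wedge_wedge_apply] at hI
  -- Only the components of even total parity survive: three even factors, or one even and two odd
  -- factors.
  have hI2 : ∀ x y z, g.form (g.bracket x y) z = det3 a b c x y z - ssym3 a b' c' x y z
      + ssym3 b a' c' x y z - ssym3 c a' b' x y z := by
    intro x y z
    rw [g.form_bracket_eq_sum]
    simp only [hI, det3, ssym3, ha, hb, hc, ha', hb', hc', LinearMap.comp_apply,
      LieSuperalgebra.evenProj_evenProj, LieSuperalgebra.evenProj_oddProj,
      LieSuperalgebra.oddProj_oddProj, LieSuperalgebra.oddProj_evenProj, map_zero]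
    ring
  -- On a triple of equal odd vectors all six terms of the product coincide and equal `-a' b' c'`.
  have hooo : ∀ x, a' x * b' x * c' x = 0 := by
    intro x
    have hx := g.form_bracket_eq_zero (by decide) (g.oddProj_mem x) (g.oddProj_mem x)
      (g.oddProj_mem x)
    rw [hI] at hx
    simp only [LieSuperalgebra.evenProj_oddProj,
      LieSuperalgebra.oddProj_oddProj, map_zero] at hx
    simp only [ha', hb', hc', LinearMap.comp_apply]
    linear_combination (-1 / 6) * hx
  have heeo : ∀ x y z, a' z * (b x * c y - b y * c x) - b' z * (a x * c y - a y * c x)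
      + c' z * (a x * b y - a y * b x) = 0 := by
    intro x y z
    have hx := g.form_bracket_eq_zero (by decide) (g.evenProj_mem x) (g.evenProj_mem y)
      (g.oddProj_mem z)
    rw [hI] at hx
    simp only [LieSuperalgebra.evenProj_evenProj, LieSuperalgebra.evenProj_oddProj,
      LieSuperalgebra.oddProj_oddProj, LieSuperalgebra.oddProj_evenProj, map_zero] at hx
    simp only [ha, hb, hc, ha', hb', hc', LinearMap.comp_apply]
    linear_combination hx
  have hA : (∀ x y z, g.form (g.bracket x y) z = det3 a b c x y z) →
      ∃ α β γ : Module.Dual ℂ V, (∀ x ∈ g.part 1, α x = 0 ∧ β x = 0 ∧ γ x = 0) ∧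
        ∀ x y z, g.form (g.bracket x y) z = det3 α β γ x y z := fun h =>
    ⟨a, b, c, fun x hx => ⟨a1 x hx, b1 x hx, c1 x hx⟩, h⟩
  -- One odd part vanishes, say that of the first factor. If a second one vanishes too, every mixed
  -- term drops out. Otherwise `hd` makes two of the even 2-forms proportional, which kills `a ∧ b ∧
  -- c` and leaves a single mixed term. The other two cases are analogous.
  rcases eq_zero_of_mul_mul_eq_zero hooo with h0 | h0 | h0
  · by_cases h1 : b' = 0
    · exact .inl (hA fun x y z => by rw [hI2, h0, h1]; simp [ssym3])
    · obtain ⟨t, ht⟩ := DFunLike.ne_iff.1 h1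
      have ht : b' t ≠ 0 := ht
      have hd : ∀ x y, a x * c y - a y * c x = (c' t / b' t) * (a x * b y - a y * b x) := by
        intro x y
        have := heeo x y t
        rw [h0, LinearMap.zero_apply] at this
        field_simp
        linear_combination -this
      refine .inr ⟨-a, b', c', fun x hx => by simp [a1 x hx], fun x hx => ⟨b0 x hx, c0 x hx⟩,
        fun x y z => ?_⟩
      rw [hI2, h0]
      simp only [det3, ssym3, LinearMap.neg_apply, LinearMap.zero_apply]
      linear_combination -b x * hd y z + b y * hd x z - b z * hd x y
  · by_cases h1 : c' = 0
    · exact .inl (hA fun x y z => by rw [hI2, h0, h1]; simp [ssym3])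
    · obtain ⟨t, ht⟩ := DFunLike.ne_iff.1 h1
      have ht : c' t ≠ 0 := ht
      have hd : ∀ x y, a x * b y - a y * b x = -(a' t / c' t) * (b x * c y - b y * c x) := by
        intro x y
        have := heeo x y t
        rw [h0, LinearMap.zero_apply] at this
        field_simp
        linear_combination this
      refine .inr ⟨b, a', c', fun x hx => by simp [b1 x hx], fun x hx => ⟨a0 x hx, c0 x hx⟩,
        fun x y z => ?_⟩
      rw [hI2, h0]
      simp only [det3, ssym3, LinearMap.zero_apply]
      linear_combination c x * hd y z - c y * hd x z + c z * hd x y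
  · by_cases h1 : a' = 0
    · exact .inl (hA fun x y z => by rw [hI2, h0, h1]; simp [ssym3])
    · obtain ⟨t, ht⟩ := DFunLike.ne_iff.1 h1
      have ht : a' t ≠ 0 := ht
      have hd : ∀ x y, b x * c y - b y * c x = (b' t / a' t) * (a x * c y - a y * c x) := by
        intro x y
        have := heeo x y t
        rw [h0, LinearMap.zero_apply] at this
        field_simp
        linear_combination this
      refine .inr ⟨-c, a', b', fun x hx => by simp [c1 x hx], fun x hx => ⟨a0 x hx, b0 x hx⟩,
        fun x y z => ?_⟩
      rw [hI2, h0]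
      simp only [det3, ssym3, LinearMap.neg_apply, LinearMap.zero_apply]
      linear_combination a x * hd y z - a y * hd x z + a z * hd x y

end QuadraticLieSuperalgebra

namespace QuadraticLieSuperalgebra

/-! ### Invariants of i-isomorphism. -/

section Isomorphism

variable {V W U : Type*} [AddCommGroup V] [Module ℂ V] [AddCommGroup W] [Module ℂ W]
  [AddCommGroup U] [Module ℂ U] {g : QuadraticLieSuperalgebra V} {h : QuadraticLieSuperalgebra W}
  {k : QuadraticLieSuperalgebra U}

theorem IIsomorphic.symm (H : g.IIsomorphic h) : h.IIsomorphic g := by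
  obtain ⟨A, h1, h2, h3⟩ := H
  refine ⟨A.symm, fun i => ?_, fun x y => ?_, fun x y => ?_⟩
  · rw [← h1 i, ← Submodule.map_comp]
    simp
  · rw [LinearEquiv.symm_apply_eq, h2]
    simp
  · rw [← h3]
    simp

theorem IIsomorphic.trans (H : g.IIsomorphic h) (H' : h.IIsomorphic k) : g.IIsomorphic k := by
  obtain ⟨A, h1, h2, h3⟩ := H
  obtain ⟨A', h1', h2', h3'⟩ := H'
  refine ⟨A.trans A', fun i => ?_, fun x y => ?_, fun x y => ?_⟩
  · rw [← h1' i, ← h1 i, ← Submodule.map_comp]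
    rfl
  · simp [h2, h2']
  · simp [h3, h3']

theorem IIsomorphic.finrank_eq (H : g.IIsomorphic h) : Module.finrank ℂ V = Module.finrank ℂ W :=
  H.choose.finrank_eq

theorem IIsomorphic.part_eq_bot (H : g.IIsomorphic h) {i : ZMod 2} (hi : g.part i = ⊥) :
    h.part i = ⊥ := by
  obtain ⟨A, h1, -, -⟩ := H
  rw [← h1 i, hi, Submodule.map_bot]

end Isomorphism

/-! ### From a frame to an i-isomorphism with a table. -/

section Frame

variable {V : Type*} [AddCommGroup V] [Module ℂ V] (g : QuadraticLieSuperalgebra V)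

/-- Linear forms are represented by vectors. -/
theorem exists_form_eq [FiniteDimensional ℂ V] (α : Module.Dual ℂ V) : ∃ a, g.form a = α :=
  ⟨(g.form.toDual g.form_nondegenerate).symm α, by
    ext x
    rw [← LinearMap.BilinForm.toDual_def g.form_nondegenerate, LinearEquiv.apply_symm_apply]⟩

variable {g}

/-- If the common kernel of `B(a, ·), B(b, ·), B(c, ·)` is central and the centre is isotropic,
then the centre lies in the span of `a, b, c`. -/
theorem IsReduced.center_le_span (hg : g.IsReduced) {a b c : V}
    (hc : ∀ v, g.form a v = 0 → g.form b v = 0 → g.form c v = 0 → v ∈ g.center) :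
    g.center ≤ Submodule.span ℂ {a, b, c} := by
  intro v hv
  -- The common kernel is central and the centre is isotropic, so `B(v, ·)` vanishes on that kernel
  -- and is a combination of the three forms.
  have hspan : g.form v ∈ Submodule.span ℂ (Set.range ![g.form a, g.form b, g.form c]) := by
    refine mem_span_of_iInf_ker_le_ker fun u hu => ?_
    simp only [Submodule.mem_iInf, LinearMap.mem_ker] at hu
    exact hg.2 v hv u (hc u (hu 0) (hu 1) (hu 2))
  have hr : Set.range ![g.form a, g.form b, g.form c] = g.form '' {a, b, c} := by
    ext f
    simp only [Matrix.range_cons, Matrix.range_empty, Set.union_empty, Set.image_insert_eq,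
      Set.image_singleton, Set.singleton_union]
  rw [hr, ← Submodule.map_span] at hspan
  obtain ⟨w, hw, hwv⟩ := hspan
  have : w = v := g.eq_of_form_eq fun y => by rw [hwv]
  rwa [← this]

theorem ofTable_form_bracket_single {n : ℕ} {p : Fin n → ZMod 2} {c : Fin n → Fin n → Fin n → ℤ}
    {r : ℂˣ} {b : Fin n → Fin n → ℤ} (H : TableLaws p c b) (i j k : Fin n) :
    (ofTable p c r b H).form
      ((ofTable p c r b H).bracket (Pi.single i 1) (Pi.single j 1)) (Pi.single k 1) =
      r * ((∑ m, c i j m * b m k : ℤ) : ℂ) := by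
  change tableForm (r : ℂ) b (tableBracket c (Pi.single i 1) (Pi.single j 1)) (Pi.single k 1) = _
  rw [tableBracket_single]
  simp only [map_sum, map_smul, LinearMap.sum_apply, LinearMap.smul_apply, tableForm_single,
    smul_eq_mul, Int.cast_sum, Int.cast_mul, Finset.mul_sum]
  exact Finset.sum_congr rfl fun m _ => by ring

/-- A homogeneous family of vectors which reproduces a table and whose span contains the
representatives of the linear forms which cut out the centre is a basis, and identifies a reduced
quadratic Lie superalgebra with the algebra given by the table. -/
theorem IsReduced.iIsomorphic_ofTable (hg : g.IsReduced) {n : ℕ} {p : Fin n → ZMod 2}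
    {c : Fin n → Fin n → Fin n → ℤ} {r : ℂˣ} {b : Fin n → Fin n → ℤ} (H : TableLaws p c b)
    (e : Fin n → V) (hp : ∀ i, e i ∈ g.part (p i))
    (hform : ∀ i j, g.form (e i) (e j) = r * b i j)
    (hbr : ∀ i j k, g.form (g.bracket (e i) (e j)) (e k) =
      r * ((∑ m, c i j m * b m k : ℤ) : ℂ))
    {u v w : V} (hc : ∀ x, g.form u x = 0 → g.form v x = 0 → g.form w x = 0 → x ∈ g.center)
    (hu : u ∈ Submodule.span ℂ (Set.range e)) (hv : v ∈ Submodule.span ℂ (Set.range e))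
    (hw : w ∈ Submodule.span ℂ (Set.range e)) :
    g.IIsomorphic (ofTable p c r b H) := by
  set T := ofTable p c r b H with hT
  set φ : (Fin n → ℂ) →ₗ[ℂ] V := Fintype.linearCombination ℂ e with hφ
  have hφe : ∀ i, φ (Pi.single i 1) = e i := fun i => by
    simp [hφ, Fintype.linearCombination_apply_single]
  have hrange : LinearMap.range φ = Submodule.span ℂ (Set.range e) :=
    Fintype.range_linearCombination ℂ e
  have hφform : ∀ x y, g.form (φ x) (φ y) = T.form x y := by
    intro x y
    have : g.form.compl₁₂ φ φ = T.form := by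
      refine table_ext fun i => table_ext fun j => ?_
      rw [LinearMap.compl₁₂_apply, hφe, hφe, hform]
      exact (tableForm_single (r : ℂ) b i j).symm
    rw [← this, LinearMap.compl₁₂_apply]
  -- An isometry out of a non-degenerate space is injective.
  have hinj : Function.Injective φ := by
    rw [injective_iff_map_eq_zero]
    intro x hx
    refine T.eq_zero_of_form_eq_zero fun y => ?_
    rw [← hφform, hx, map_zero, LinearMap.zero_apply]
  -- Subtract from `x` its orthogonal projection `φ y` onto the range. The difference is orthogonal
  -- to `u, v, w`, hence central, hence in their span, which lies in the range.
  have hsurj : Function.Surjective φ := by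
    rw [← LinearMap.range_eq_top, eq_top_iff]
    intro x _
    obtain ⟨y, hy⟩ := T.exists_form_eq (g.form x ∘ₗ φ)
    have hker : ∀ t ∈ Submodule.span ℂ (Set.range e), g.form (x - φ y) t = 0 := by
      intro t ht
      rw [← hrange] at ht
      obtain ⟨s, rfl⟩ := ht
      have := LinearMap.congr_fun hy s
      rw [map_sub, LinearMap.sub_apply, hφform, this, LinearMap.comp_apply, sub_self]
    have hker' : ∀ t ∈ Set.range e, g.form t (x - φ y) = 0 := by
      rintro _ ⟨i, rfl⟩
      have hi := hker _ (Submodule.subset_span ⟨i, rfl⟩)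
      have h2 : ∀ q : ZMod 2, q = 0 ∨ q = 1 := by decide
      have hpi := hp i
      rcases h2 (p i) with h | h <;> rw [h] at hpi
      · rw [g.form_comm_even_left hpi, hi]
      · rw [g.form_comm_odd_left hpi, hi, neg_zero]
    have hker2 : ∀ t ∈ Submodule.span ℂ (Set.range e), g.form t (x - φ y) = 0 := by
      intro t ht
      induction ht using Submodule.span_induction with
      | mem t h => exact hker' t h
      | zero => simp
      | add s t _ _ hs ht => rw [map_add, LinearMap.add_apply, hs, ht, add_zero]
      | smul a t _ ht => rw [map_smul, LinearMap.smul_apply, ht, smul_zero]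
    have hmem := hg.center_le_span hc (hc _ (hker2 u hu) (hker2 v hv) (hker2 w hw))
    have hle : Submodule.span ℂ {u, v, w} ≤ LinearMap.range φ := by
      rw [hrange, Submodule.span_le]
      rintro t (rfl | rfl | rfl)
      exacts [hu, hv, hw]
    have := add_mem (hle hmem) (LinearMap.mem_range_self φ y)
    rwa [sub_add_cancel] at this
  have hφbr : ∀ x y, φ (T.bracket x y) = g.bracket (φ x) (φ y) := by
    intro x y
    refine g.eq_of_form_eq fun z => ?_
    obtain ⟨z, rfl⟩ := hsurj z
    rw [hφform]
    have : T.bracket.compr₂ T.form = (g.bracket.compl₁₂ φ φ).compr₂ (φ.dualMap ∘ₗ g.form) := by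
      refine table_ext fun i => table_ext fun j => table_ext fun k => ?_
      simp only [LinearMap.compr₂_apply, LinearMap.compl₁₂_apply, LinearMap.comp_apply,
        LinearMap.dualMap_apply, hφe, hbr]
      exact ofTable_form_bracket_single H i j k
    exact LinearMap.congr_fun (LinearMap.congr_fun₂ this x y) z
  have hle : ∀ i, ∀ x ∈ T.part i, φ x ∈ g.part i := by
    intro i x hx
    replace hx : x ∈ tablePart p i := hx
    induction hx using Submodule.span_induction with
    | mem x h =>
      obtain ⟨a, rfl, rfl⟩ := h
      rw [hφe]
      exact hp a
    | zero => simp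
    | add x y _ _ hx hy =>
      rw [map_add]
      exact add_mem hx hy
    | smul r x _ hx =>
      rw [map_smul]
      exact Submodule.smul_mem _ _ hx
  -- Since `φ` respects parities, the component of a preimage of the wrong parity is sent into both
  -- parts of `g`, hence to zero.
  have hpart : ∀ i, (T.part i).map φ = g.part i := by
    intro i
    refine le_antisymm (Submodule.map_le_iff_le_comap.2 (hle i)) fun x hx => ?_
    obtain ⟨y, rfl⟩ := hsurj x
    have hdis := Submodule.disjoint_def.1 g.isCompl_part.disjoint
    have h0 := hle 0 _ (T.evenProj_mem y)
    have h1 := hle 1 _ (T.oddProj_mem y)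
    have hy := T.apply_eq_evenProj_add_oddProj φ y
    have h2 : ∀ q : ZMod 2, q = 0 ∨ q = 1 := by decide
    rcases h2 i with rfl | rfl
    · have : φ (T.oddProj y) = 0 := hdis _ (by
        rw [← add_sub_cancel_left (φ (T.evenProj y)) (φ (T.oddProj y)), ← hy]
        exact sub_mem hx h0) h1
      rw [hy, this, add_zero]
      exact Submodule.mem_map_of_mem (T.evenProj_mem y)
    · have : φ (T.evenProj y) = 0 := hdis _ h0 (by
        rw [← add_sub_cancel_right (φ (T.evenProj y)) (φ (T.oddProj y)), ← hy]
        exact sub_mem hx h1)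
      rw [hy, this, zero_add]
      exact Submodule.mem_map_of_mem (T.oddProj_mem y)
  exact IIsomorphic.symm ⟨LinearEquiv.ofBijective φ ⟨hinj, hsurj⟩, hpart, hφbr, hφform⟩

end Frame

end QuadraticLieSuperalgebra

namespace QuadraticLieSuperalgebra

/-! ### Criteria for being elementary and for type `S₃`. -/

section Criteria

variable {V : Type*} [AddCommGroup V] [Module ℂ V] {g : QuadraticLieSuperalgebra V}

theorem isElementary_of_det3 {α β γ : Module.Dual ℂ V}
    (hodd : ∀ x ∈ g.part 1, α x = 0 ∧ β x = 0 ∧ γ x = 0) {r : ℂ}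
    (h : ∀ x y z, g.form (g.bracket x y) z = r * det3 α β γ x y z) : g.IsElementary := by
  refine ⟨r • α, β, γ, funext fun X => ?_⟩
  obtain ⟨x, y, z, rfl⟩ : ∃ x y z, X = ![x, y, z] :=
    ⟨X 0, X 1, X 2, by ext i; fin_cases i <;> rfl⟩
  rw [g.wedge_wedge_apply, invariant_apply, h, det3]
  have o := fun t => hodd _ (g.oddProj_mem t)
  have hα := fun t => g.apply_eq_evenProj_add_oddProj α t
  have hβ := fun t => g.apply_eq_evenProj_add_oddProj β t
  have hγ := fun t => g.apply_eq_evenProj_add_oddProj γ t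
  rw [hα x, hα y, hα z, hβ x, hβ y, hβ z, hγ x, hγ y, hγ z]
  simp only [LinearMap.smul_apply, smul_eq_mul, (o _).1, (o _).2.1, (o _).2.2]
  ring

/-- The sign convention of `wedge` makes `α ∧ β ∧ γ` equal to `-ssym3 α β γ` for these parities,
whence the factor `-α`. -/
theorem isElementary_of_ssym3 {α β γ : Module.Dual ℂ V} (hodd : ∀ x ∈ g.part 1, α x = 0)
    (heven : ∀ x ∈ g.part 0, β x = 0 ∧ γ x = 0)
    (h : ∀ x y z, g.form (g.bracket x y) z = ssym3 α β γ x y z) : g.IsElementary := by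
  refine ⟨-α, β, γ, funext fun X => ?_⟩
  obtain ⟨x, y, z, rfl⟩ : ∃ x y z, X = ![x, y, z] :=
    ⟨X 0, X 1, X 2, by ext i; fin_cases i <;> rfl⟩
  rw [g.wedge_wedge_apply, invariant_apply, h, ssym3]
  have o := fun t => hodd _ (g.oddProj_mem t)
  have e := fun t => heven _ (g.evenProj_mem t)
  have hα := fun t => g.apply_eq_evenProj_add_oddProj α t
  have hβ := fun t => g.apply_eq_evenProj_add_oddProj β t
  have hγ := fun t => g.apply_eq_evenProj_add_oddProj γ t
  rw [hα x, hα y, hα z, hβ x, hβ y, hβ z, hγ x, hγ y, hγ z]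
  simp only [LinearMap.neg_apply, o, (e _).1, (e _).2]
  ring

/-- For a quadratic Lie algebra whose invariant is a nonzero product `α ∧ β ∧ γ`, the linear forms
annihilating the invariant are the combinations of `α, β, γ`. -/
theorem isSingularS3_of_det3 (hpart : g.part 1 = ⊥) {α β γ : Module.Dual ℂ V} {r : ℂ} (hr : r ≠ 0)
    (h : ∀ x y z, g.form (g.bracket x y) z = r * det3 α β γ x y z) {u v w : V}
    (hα : α u = 1 ∧ α v = 0 ∧ α w = 0) (hβ : β u = 0 ∧ β v = 1 ∧ β w = 0)
    (hγ : γ u = 0 ∧ γ v = 0 ∧ γ w = 1) : g.IsSingularS3 := by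
  have hodd : ∀ x, g.oddProj x = 0 := fun x => by
    have := g.oddProj_mem x
    rwa [hpart, Submodule.mem_bot] at this
  have heven : ∀ x, g.evenProj x = x := fun x => by
    conv_rhs => rw [← g.evenProj_add_oddProj x, hodd, add_zero]
  have hwedge : ∀ (δ : Module.Dual ℂ V) (X : Fin 4 → V), g.wedge δ g.invariant X =
      δ (X 0) * (r * det3 α β γ (X 1) (X 2) (X 3)) - δ (X 1) * (r * det3 α β γ (X 0) (X 2) (X 3))
      + δ (X 2) * (r * det3 α β γ (X 0) (X 1) (X 3))
      - δ (X 3) * (r * det3 α β γ (X 0) (X 1) (X 2)) := by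
    intro δ X
    simp only [← h]
    simp only [LieSuperalgebra.wedge, hodd, heven, map_zero, zero_mul, add_zero,
      invariant]
    simp [Fin.sum_univ_succ, Fin.succAbove]
    ring
  constructor
  · intro h0
    have h1 := h u v w
    rw [h0, det3, hα.1, hα.2.1, hα.2.2, hβ.1, hβ.2.1, hβ.2.2, hγ.1, hγ.2.1, hγ.2.2] at h1
    simp at h1
    exact hr h1.symm
  · have hspan : g.dupSpace = Submodule.span ℂ (Set.range ![α, β, γ]) := by
      apply le_antisymm
      · intro δ hδ
        have hδ' : g.wedge δ g.invariant = 0 := hδ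
        have hδ2 : δ = δ u • α + δ v • β + δ w • γ := by
          ext x
          -- As `α ∧ β ∧ γ` takes the value `1` on the dual vectors `u, v, w`, evaluating `δ ∧ I`
          -- here isolates `δ x`.
          have h1 := congrFun hδ' ![x, u, v, w]
          rw [hwedge] at h1
          simp only [Matrix.cons_val_zero, Matrix.cons_val_one, Matrix.cons_val, det3, hα.1,
            hα.2.1, hα.2.2, hβ.1, hβ.2.1, hβ.2.2, hγ.1, hγ.2.1, hγ.2.2, Pi.zero_apply] at h1
          have h2 : r * (δ x - (δ u * α x + δ v * β x + δ w * γ x)) = 0 := by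
            linear_combination h1
          simpa using sub_eq_zero.1 ((mul_eq_zero.1 h2).resolve_left hr)
        rw [hδ2]
        exact add_mem (add_mem (Submodule.smul_mem _ _ (Submodule.subset_span ⟨0, rfl⟩))
          (Submodule.smul_mem _ _ (Submodule.subset_span ⟨1, rfl⟩)))
          (Submodule.smul_mem _ _ (Submodule.subset_span ⟨2, rfl⟩))
      · rw [Submodule.span_le]
        rintro _ ⟨i, rfl⟩
        change g.wedge _ g.invariant = 0
        funext X
        rw [hwedge]
        fin_cases i <;> simp only [Fin.zero_eta, Fin.mk_one, Fin.reduceFinMk, Matrix.cons_val_zero,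
          Matrix.cons_val_one, Matrix.cons_val, det3, Pi.zero_apply] <;> ring
    have hli : LinearIndependent ℂ ![α, β, γ] := by
      rw [Fintype.linearIndependent_iff]
      intro s hs
      simp only [Fin.sum_univ_three, Matrix.cons_val_zero, Matrix.cons_val_one,
        Matrix.cons_val] at hs
      have hs' : ∀ x, s 0 * α x + s 1 * β x + s 2 * γ x = 0 := fun x => by
        simpa using LinearMap.congr_fun hs x
      have h0 := hs' u
      have h1 := hs' v
      have h2 := hs' w
      simp only [hα.1, hα.2.1, hα.2.2, hβ.1, hβ.2.1, hβ.2.2, hγ.1, hγ.2.1, hγ.2.2, mul_one,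
        mul_zero, add_zero, zero_add] at h0 h1 h2
      intro i
      fin_cases i <;> assumption
    rw [dup, hspan, finrank_span_eq_card hli, Fintype.card_fin]

end Criteria

/-! ### Properties of an algebra read off from its table. -/

section Table

variable {n : ℕ} {p : Fin n → ZMod 2} {c : Fin n → Fin n → Fin n → ℤ} {r : ℂˣ}
  {b : Fin n → Fin n → ℤ} (H : TableLaws p c b)

/-- If `c m k l` is nonzero only for `m = i`, the `l`-th coordinate of `[x, e_k]` is `x i * c i k
l`, so the `i`-th coordinate of a central vector vanishes. The condition `hb` asks that every
nonzero entry of the form involve such an index, so all terms of `B(x, y)` vanish on the centre. -/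
theorem isReduced_ofTable (hn : 0 < n)
    (hb : ∀ i j, b i j = 0 ∨ (∃ k l, c i k l ≠ 0 ∧ ∀ m, m ≠ i → c m k l = 0) ∨
      (∃ k l, c j k l ≠ 0 ∧ ∀ m, m ≠ j → c m k l = 0)) : (ofTable p c r b H).IsReduced := by
  have key : ∀ x ∈ (ofTable p c r b H).center, ∀ i,
      (∃ k l, c i k l ≠ 0 ∧ ∀ m, m ≠ i → c m k l = 0) → x i = 0 := by
    rintro x hx i ⟨k, l, h1, h2⟩
    have hx : tableBracket c x = 0 := hx
    have h3 : tableBracket c x (Pi.single k 1) l = x i * c i k l := by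
      simp only [tableBracket, LinearMap.mk₂_apply, Pi.single_apply, mul_ite, mul_one, mul_zero,
        ite_mul, zero_mul, Finset.sum_ite_eq', Finset.mem_univ, if_true]
      exact Finset.sum_eq_single i (fun m _ hm => by rw [h2 m hm]; simp) (by simp)
    rw [hx] at h3
    exact (mul_eq_zero.1 h3.symm).resolve_right (by exact_mod_cast h1)
  refine ⟨?_, fun x hx y hy => ?_⟩
  · have : Nonempty (Fin n) := ⟨⟨0, hn⟩⟩
    infer_instance
  · change tableForm (r : ℂ) b x y = 0
    rw [tableForm, LinearMap.mk₂_apply]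
    refine Finset.sum_eq_zero fun i _ => Finset.sum_eq_zero fun j _ => ?_
    rcases hb i j with h | h | h
    · simp [h]
    · simp [key x hx i h]
    · simp [key y hy j h]

/-- The linear form on `ℂⁿ` with integral coefficients `A`. -/
noncomputable def tableDual (A : Fin n → ℤ) : Module.Dual ℂ (Fin n → ℂ) :=
  ∑ i, (A i : ℂ) • LinearMap.proj i

@[simp]
theorem tableDual_single (A : Fin n → ℤ) (i : Fin n) : tableDual A (Pi.single i 1) = A i := by
  simp [tableDual, Pi.single_apply]

theorem tableDual_eq_zero {A : Fin n → ℤ} {i : ZMod 2} (h : ∀ a, p a = i → A a = 0) :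
    ∀ x ∈ tablePart p i, tableDual A x = 0 :=
  table_ext_span (h := 0) fun a ha => by simp [h a ha]

theorem ofTable_eq_det3 {A B C : Fin n → ℤ}
    (h : ∀ i j k, ∑ m, c i j m * b m k = A i * (B j * C k - B k * C j)
      - A j * (B i * C k - B k * C i) + A k * (B i * C j - B j * C i)) (x y z : Fin n → ℂ) :
    (ofTable p c r b H).form ((ofTable p c r b H).bracket x y) z =
      r * det3 (tableDual A) (tableDual B) (tableDual C) x y z := by
  -- `M f g h` is the tensor `f ⊗ g ⊗ h`. Both sides are then trilinear maps, to be compared on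
  -- basis vectors.
  let M : Module.Dual ℂ (Fin n → ℂ) → Module.Dual ℂ (Fin n → ℂ) → Module.Dual ℂ (Fin n → ℂ) →
      (Fin n → ℂ) →ₗ[ℂ] (Fin n → ℂ) →ₗ[ℂ] (Fin n → ℂ) →ₗ[ℂ] ℂ :=
    fun f g h => f.smulRight (g.smulRight h)
  set α := tableDual A
  set β := tableDual B
  set γ := tableDual C
  have : (ofTable p c r b H).bracket.compr₂ (ofTable p c r b H).form =
      (r : ℂ) • (M α β γ - M α γ β - M β α γ + M γ α β + M β γ α - M γ β α) := by
    refine table_ext fun i => table_ext fun j => table_ext fun k => ?_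
    rw [LinearMap.compr₂_apply, ofTable_form_bracket_single, h]
    simp [M, α, β, γ]
    ring
  have h2 := LinearMap.congr_fun (LinearMap.congr_fun₂ this x y) z
  rw [LinearMap.compr₂_apply] at h2
  rw [h2, det3]
  simp [M]
  ring

theorem ofTable_eq_ssym3 {A B C : Fin n → ℤ}
    (h : ∀ i j k, ∑ m, c i j m * b m k = A i * (B j * C k + B k * C j)
      - A j * (B i * C k + B k * C i) + A k * (B i * C j + B j * C i)) (x y z : Fin n → ℂ) :
    (ofTable p c 1 b H).form ((ofTable p c 1 b H).bracket x y) z =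
      ssym3 (tableDual A) (tableDual B) (tableDual C) x y z := by
  let M : Module.Dual ℂ (Fin n → ℂ) → Module.Dual ℂ (Fin n → ℂ) → Module.Dual ℂ (Fin n → ℂ) →
      (Fin n → ℂ) →ₗ[ℂ] (Fin n → ℂ) →ₗ[ℂ] (Fin n → ℂ) →ₗ[ℂ] ℂ :=
    fun f g h => f.smulRight (g.smulRight h)
  set α := tableDual A
  set β := tableDual B
  set γ := tableDual C
  have : (ofTable p c 1 b H).bracket.compr₂ (ofTable p c 1 b H).form =
      M α β γ + M α γ β - M β α γ - M γ α β + M β γ α + M γ β α := by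
    refine table_ext fun i => table_ext fun j => table_ext fun k => ?_
    rw [LinearMap.compr₂_apply, ofTable_form_bracket_single, h]
    simp [M, α, β, γ]
    ring
  have h2 := LinearMap.congr_fun (LinearMap.congr_fun₂ this x y) z
  rw [LinearMap.compr₂_apply] at h2
  rw [h2, ssym3]
  simp [M]
  ring

theorem finrank_tablePart (p : Fin n → ZMod 2) (i : ZMod 2) :
    Module.finrank ℂ (tablePart p i) = Fintype.card {a // p a = i} := by
  have h : tablePart p i = Submodule.span ℂ
      (Set.range fun a : {a // p a = i} => (Pi.single a.1 1 : Fin n → ℂ)) := by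
    rw [tablePart]
    congr 1
    ext x
    simp [eq_comm]
  rw [h]
  refine finrank_span_eq_card ?_
  have := (Pi.basisFun ℂ (Fin n)).linearIndependent.comp (fun a : {a // p a = i} => a.1)
    Subtype.val_injective
  convert this using 2
  simp

theorem tablePart_eq_bot (h : ∀ a, p a = 0) : tablePart p 1 = ⊥ := by
  rw [tablePart, Submodule.span_eq_bot]
  rintro x ⟨a, ha, -⟩
  rw [h a] at ha
  exact absurd ha (by decide)

/-- The properties of a table with even basis vectors and invariant `e_i* ∧ e_j* ∧ e_k*`. -/
theorem ofTable_lie (hn : 0 < n) (hp : ∀ a, p a = 0)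
    (hb : ∀ i j, b i j = 0 ∨ (∃ k l, c i k l ≠ 0 ∧ ∀ m, m ≠ i → c m k l = 0) ∨
      (∃ k l, c j k l ≠ 0 ∧ ∀ m, m ≠ j → c m k l = 0)) {A B C : Fin n → ℤ}
    (h : ∀ i j k, ∑ m, c i j m * b m k = A i * (B j * C k - B k * C j)
      - A j * (B i * C k - B k * C i) + A k * (B i * C j - B j * C i)) {i j k : Fin n}
    (hA : A i = 1 ∧ A j = 0 ∧ A k = 0) (hB : B i = 0 ∧ B j = 1 ∧ B k = 0)
    (hC : C i = 0 ∧ C j = 0 ∧ C k = 1) :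
    (ofTable p c r b H).IsReduced ∧ (ofTable p c r b H).IsElementary ∧
      (ofTable p c r b H).IsSingularS3 ∧ (ofTable p c r b H).part 1 = ⊥ := by
  have h1 : (ofTable p c r b H).part 1 = ⊥ := tablePart_eq_bot hp
  refine ⟨isReduced_ofTable H hn hb, isElementary_of_det3 (fun x hx => ?_) (ofTable_eq_det3 H h),
    isSingularS3_of_det3 h1 r.ne_zero (ofTable_eq_det3 H h) (u := Pi.single i 1)
      (v := Pi.single j 1) (w := Pi.single k 1) ?_ ?_ ?_, h1⟩
  · rw [h1, Submodule.mem_bot] at hx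
    simp [hx]
  · simp [hA]
  · simp [hB]
  · simp [hC]

/-- The properties of a table with two even basis vectors and invariant a product of an even
linear form with two odd ones. -/
theorem ofTable_super (hn : 0 < n) (hp : Fintype.card {a // p a = 0} = 2)
    (hb : ∀ i j, b i j = 0 ∨ (∃ k l, c i k l ≠ 0 ∧ ∀ m, m ≠ i → c m k l = 0) ∨
      (∃ k l, c j k l ≠ 0 ∧ ∀ m, m ≠ j → c m k l = 0)) {A B C : Fin n → ℤ}
    (h : ∀ i j k, ∑ m, c i j m * b m k = A i * (B j * C k + B k * C j)
      - A j * (B i * C k + B k * C i) + A k * (B i * C j + B j * C i))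
    (hA : ∀ a, p a = 1 → A a = 0) (hB : ∀ a, p a = 0 → B a = 0) (hC : ∀ a, p a = 0 → C a = 0) :
    (ofTable p c 1 b H).IsReduced ∧ (ofTable p c 1 b H).IsElementary ∧
      Module.finrank ℂ ((ofTable p c 1 b H).part 0) = 2 :=
  ⟨isReduced_ofTable H hn hb, isElementary_of_ssym3 (tableDual_eq_zero hA)
    (fun x hx => ⟨tableDual_eq_zero hB x hx, tableDual_eq_zero hC x hx⟩) (ofTable_eq_ssym3 H h),
    (finrank_tablePart p 0).trans hp⟩

end Table

/-! ### The members of the list have the stated properties. -/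

section Models

theorem LieModel.properties (m : LieModel) : m.algebra.IsReduced ∧ m.algebra.IsElementary ∧
    m.algebra.IsSingularS3 ∧ m.algebra.part 1 = ⊥ := by
  cases m with
  | g3 r =>
    exact ofTable_lie (r := r) (A := ![1, 0, 0]) (B := ![0, 1, 0]) (C := ![0, 0, 1])
      (i := 0) (j := 1) (k := 2)
      (by constructor <;> decide +kernel) (by decide) (by decide) (by decide +kernel)
      (by decide +kernel) (by decide) (by decide) (by decide)
  | g4 =>
    exact ofTable_lie (A := ![1, 0, 0, 0]) (B := ![0, 1, 0, 0]) (C := ![0, 0, 1, 0])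
      (i := 0) (j := 1) (k := 2)
      (by constructor <;> decide +kernel) (by decide) (by decide) (by decide +kernel)
      (by decide +kernel) (by decide) (by decide) (by decide)
  | g5 =>
    exact ofTable_lie (A := ![1, 0, 0, 0, 0]) (B := ![0, 1, 0, 0, 0]) (C := ![0, 0, 1, 0, 0])
      (i := 0) (j := 1) (k := 2)
      (by constructor <;> decide +kernel) (by decide) (by decide) (by decide +kernel)
      (by decide +kernel) (by decide) (by decide) (by decide)
  | g6 =>
    exact ofTable_lie (A := ![1, 0, 0, 0, 0, 0]) (B := ![0, 1, 0, 0, 0, 0])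
      (C := ![0, 0, 1, 0, 0, 0]) (i := 0) (j := 1) (k := 2)
      (by constructor <;> decide +kernel) (by decide) (by decide)
      (by decide +kernel) (by decide +kernel) (by decide) (by decide) (by decide)

theorem SuperModel.properties (m : SuperModel) : m.algebra.IsReduced ∧ m.algebra.IsElementary ∧
    Module.finrank ℂ (m.algebra.part 0) = 2 := by
  cases m with
  | gs41 =>
    exact ofTable_super (A := ![0, -1, 0, 0]) (B := ![0, 0, 0, 1]) (C := ![0, 0, 0, 1])
      (by constructor <;> decide +kernel) (by decide) (by decide) (by decide +kernel)
      (by decide +kernel) (by decide) (by decide) (by decide)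
  | gs42 =>
    exact ofTable_super (A := ![0, 1, 0, 0]) (B := ![0, 0, 1, 0]) (C := ![0, 0, 0, 1])
      (by constructor <;> decide +kernel) (by decide) (by decide) (by decide +kernel)
      (by decide +kernel) (by decide) (by decide) (by decide)
  | gs6 =>
    exact ofTable_super (A := ![0, -1, 0, 0, 0, 0]) (B := ![0, 0, 0, 0, 1, 0])
      (C := ![0, 0, 0, 0, 0, 1])
      (by constructor <;> decide +kernel) (by decide) (by decide) (by decide +kernel)
      (by decide +kernel) (by decide) (by decide) (by decide)

end Models

end QuadraticLieSuperalgebra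

namespace QuadraticLieSuperalgebra

/-! ### The members of the list are pairwise not i-isomorphic. -/

section Uniqueness

theorem tableBracket_tableBracket_single {n : ℕ} (c : Fin n → Fin n → Fin n → ℤ)
    (i j k l : Fin n) : tableBracket c (Pi.single i 1)
      (tableBracket c (Pi.single j 1) (Pi.single k 1)) l =
      ((∑ m, c j k m * c i m l : ℤ) : ℂ) := by
  simp [tableBracket_single, Finset.sum_apply, Pi.single_apply]

theorem g3_bracket_apply (r : ℂˣ) (x y : Fin 3 → ℂ) : (g3 r).bracket x y =
    ![x 1 * y 2 - x 2 * y 1, x 2 * y 0 - x 0 * y 2, x 0 * y 1 - x 1 * y 0] := by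
  funext k
  fin_cases k <;>
  · simp [g3, ofTable, tableBracket, tableBracketCoeff, Fin.sum_univ_three]
    ring

theorem g3_form_apply (r : ℂˣ) (x y : Fin 3 → ℂ) :
    (g3 r).form x y = r * (x 0 * y 0 + x 1 * y 1 + x 2 * y 2) := by
  simp [g3, ofTable, tableForm, tableFormCoeff, Fin.sum_univ_three]
  ring

/-- The bracket is the cross product and the form is `r` times the dot product, so this is the
triple product identity `x × (x × y) = (x · y) x - (x · x) y`. -/
theorem g3_double_bracket (r : ℂˣ) (x y : Fin 3 → ℂ) :
    (r : ℂ) • (g3 r).bracket x ((g3 r).bracket x y) =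
      (g3 r).form x y • x - (g3 r).form x x • y := by
  simp only [g3_bracket_apply, g3_form_apply]
  funext k
  fin_cases k <;>
  · simp
    ring

/-- The double bracket identity involves the parameter only as a factor on the left. Transporting it
along an isometric isomorphism therefore compares the two parameters. -/
theorem g3_parameter_unique {r s : ℂˣ} (h : (g3 r).IIsomorphic (g3 s)) : r = s := by
  obtain ⟨A, -, hbr, hform⟩ := h
  set x : Fin 3 → ℂ := Pi.single 0 1
  set y : Fin 3 → ℂ := Pi.single 1 1
  have h0 : (g3 r).form x y = 0 := by simp [g3_form_apply, x, y]
  have h1 : (g3 r).form x x = r := by simp [g3_form_apply, x]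
  have hr := g3_double_bracket r x y
  have hs := g3_double_bracket s (A x) (A y)
  rw [h0, h1, zero_smul, zero_sub, ← smul_neg] at hr
  have hr' := smul_right_injective _ r.ne_zero hr
  rw [hform, hform, ← hbr, ← hbr, h0, h1, hr', zero_smul, zero_sub, map_neg, smul_neg, neg_inj,
    ← map_smul, ← map_smul] at hs
  have := congrFun (A.injective hs) 1
  simp only [y, Pi.smul_apply, Pi.single_eq_same, smul_eq_mul, mul_one] at this
  exact Units.ext this.symm

/-- Two-step nilpotency, which distinguishes this algebra from `gs42`. -/
theorem gs41_double_bracket (x y z : Fin 4 → ℂ) : gs41.bracket x (gs41.bracket y z) = 0 := by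
  have key : ∀ i j k, gs41.bracket (Pi.single i 1)
      (gs41.bracket (Pi.single j 1) (Pi.single k 1)) = 0 := fun i j k => funext fun l => by
    refine (tableBracket_tableBracket_single _ i j k l).trans ?_
    rw [Pi.zero_apply, Int.cast_eq_zero]
    revert i j k l
    decide +kernel
  have h1 : ∀ i j, gs41.bracket (Pi.single i 1) ∘ₗ gs41.bracket (Pi.single j 1) = 0 :=
    fun i j => table_ext fun k => key i j k
  have h2 : ∀ i, gs41.bracket (Pi.single i 1) ∘ₗ gs41.bracket.flip z = 0 :=
    fun i => table_ext fun j => LinearMap.congr_fun (h1 i j) z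
  have h3 : gs41.bracket.flip (gs41.bracket y z) = 0 :=
    table_ext fun i => LinearMap.congr_fun (h2 i) y
  exact LinearMap.congr_fun h3 x

/-- The even vector `Y₀` (index 1) fixes the odd vector `X₁` (index 2) under the adjoint action. -/
theorem gs42_double_bracket_ne_zero : gs42.bracket (Pi.single 1 1)
    (gs42.bracket (Pi.single 1 1) (Pi.single 2 1)) ≠ 0 := by
  intro h
  have h1 := (tableBracket_tableBracket_single _ 1 1 2 2).symm.trans (congrFun h 2)
  rw [Pi.zero_apply, Int.cast_eq_zero] at h1
  revert h1
  decide +kernel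

theorem not_iIsomorphic_gs41_gs42 : ¬ gs41.IIsomorphic gs42 := by
  intro h
  obtain ⟨A, -, hbr, -⟩ := h.symm
  apply gs42_double_bracket_ne_zero
  rw [← map_eq_zero_iff A A.injective, hbr, hbr, gs41_double_bracket]

theorem SuperModel.part_one_ne_bot (m : SuperModel) : m.algebra.part 1 ≠ ⊥ := by
  have key : ∀ {n : ℕ} (p : Fin n → ZMod 2) (i : Fin n), p i = 1 → tablePart p 1 ≠ ⊥ := by
    intro n p i hi h
    have : (Pi.single i 1 : Fin n → ℂ) ∈ tablePart p 1 := Submodule.subset_span ⟨i, hi, rfl⟩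
    rw [h, Submodule.mem_bot] at this
    simpa using congrFun this i
  cases m
  · exact key ![0, 0, 1, 1] 3 rfl
  · exact key ![0, 0, 1, 1] 3 rfl
  · exact key ![0, 0, 1, 1, 1, 1] 3 rfl

theorem IIsomorphic.dim_eq {n k : ℕ} {g : QuadraticLieSuperalgebra (Fin n → ℂ)}
    {h : QuadraticLieSuperalgebra (Fin k → ℂ)} (H : g.IIsomorphic h) : n = k := by
  simpa using H.finrank_eq

theorem LieModel.eq_of_iIsomorphic {m m' : LieModel} (h : m.algebra.IIsomorphic m'.algebra) :
    m = m' := by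
  have hd : m.dim = m'.dim := h.dim_eq
  cases m <;> cases m' <;> first
    | rfl
    | exact congrArg LieModel.g3 (g3_parameter_unique h)
    | exact absurd hd (by simp [LieModel.dim])

theorem SuperModel.eq_of_iIsomorphic {m m' : SuperModel}
    (h : m.algebra.IIsomorphic m'.algebra) : m = m' := by
  have hd : m.dim = m'.dim := h.dim_eq
  cases m <;> cases m' <;> first
    | rfl
    | exact absurd h not_iIsomorphic_gs41_gs42
    | exact absurd h.symm not_iIsomorphic_gs41_gs42
    | exact absurd hd (by simp [SuperModel.dim])

theorem LieModel.not_iIsomorphic {m : LieModel} {m' : SuperModel}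
    (h : m.algebra.IIsomorphic m'.algebra) : False :=
  m'.part_one_ne_bot (h.part_eq_bot m.properties.2.2.2)

theorem IsModelledBy.unique {V : Type*} [AddCommGroup V] [Module ℂ V]
    {g : QuadraticLieSuperalgebra V} {m m' : LieModel ⊕ SuperModel} (h : g.IsModelledBy m)
    (h' : g.IsModelledBy m') : m = m' := by
  rcases m with m | m <;> rcases m' with m' | m'
  · exact congrArg _ (LieModel.eq_of_iIsomorphic (IIsomorphic.trans (IIsomorphic.symm h) h'))
  · exact (LieModel.not_iIsomorphic (IIsomorphic.trans (IIsomorphic.symm h) h')).elim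
  · exact (LieModel.not_iIsomorphic (IIsomorphic.trans (IIsomorphic.symm h') h)).elim
  · exact congrArg _ (SuperModel.eq_of_iIsomorphic (IIsomorphic.trans (IIsomorphic.symm h) h'))

end Uniqueness

/-! ### Recognising a table from the factors of the invariant. -/

section Frame

variable {V : Type*} [AddCommGroup V] [Module ℂ V] {g : QuadraticLieSuperalgebra V}
  {n : ℕ} {p : Fin n → ZMod 2} {c : Fin n → Fin n → Fin n → ℤ} {r : ℂˣ} {b : Fin n → Fin n → ℤ}

theorem form_eq_table_of_le (H : TableLaws p c b) {e : Fin n → V} (hp : ∀ i, e i ∈ g.part (p i))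
    (h : ∀ i j, i ≤ j → g.form (e i) (e j) = r * b i j) (i j : Fin n) :
    g.form (e i) (e j) = r * b i j := by
  rcases le_total i j with hij | hij
  · exact h i j hij
  · rw [g.form_supersymm _ _ _ _ (hp i) (hp j), h j i hij, H.form_symm i j, zsmul_eq_mul]
    push_cast
    ring

/-- Recognition of a table from a frame, for an invariant which is a product of even forms. -/
theorem IsReduced.iIsomorphic_of_det3 [FiniteDimensional ℂ V] (hg : g.IsReduced) {u v w : V}
    (hI : ∀ x y z, g.form (g.bracket x y) z = r * det3 (g.form u) (g.form v) (g.form w) x y z)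
    (H : TableLaws p c b) (e : Fin n → V) (hp : ∀ i, e i ∈ g.part (p i))
    (hform : ∀ i j, i ≤ j → g.form (e i) (e j) = r * b i j)
    (A B C : Fin n → ℤ) (hA : ∀ i, g.form u (e i) = A i) (hB : ∀ i, g.form v (e i) = B i)
    (hC : ∀ i, g.form w (e i) = C i)
    (h : ∀ i j k, ∑ m, c i j m * b m k = A i * (B j * C k - B k * C j)
      - A j * (B i * C k - B k * C i) + A k * (B i * C j - B j * C i))
    (hu : u ∈ Submodule.span ℂ (Set.range e)) (hv : v ∈ Submodule.span ℂ (Set.range e))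
    (hw : w ∈ Submodule.span ℂ (Set.range e)) : g.IIsomorphic (ofTable p c r b H) := by
  refine hg.iIsomorphic_ofTable H e hp (form_eq_table_of_le H hp hform) (fun i j k => ?_)
    (fun x h1 h2 h3 => g.mem_center_of_form_bracket_eq_zero fun y z => ?_) hu hv hw
  · rw [hI, h, det3]
    simp only [hA, hB, hC]
    push_cast
    ring
  · rw [hI, det3, h1, h2, h3]
    ring

/-- Recognition of a table from a frame, for an invariant which is a product of an even form and
two odd forms. -/
theorem IsReduced.iIsomorphic_of_ssym3 [FiniteDimensional ℂ V] (hg : g.IsReduced) {u v w : V}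
    (hI : ∀ x y z, g.form (g.bracket x y) z = ssym3 (g.form u) (g.form v) (g.form w) x y z)
    (H : TableLaws p c b) (e : Fin n → V) (hp : ∀ i, e i ∈ g.part (p i))
    (hform : ∀ i j, i ≤ j → g.form (e i) (e j) = b i j)
    (A B C : Fin n → ℤ) (hA : ∀ i, g.form u (e i) = A i) (hB : ∀ i, g.form v (e i) = B i)
    (hC : ∀ i, g.form w (e i) = C i)
    (h : ∀ i j k, ∑ m, c i j m * b m k = A i * (B j * C k + B k * C j)
      - A j * (B i * C k + B k * C i) + A k * (B i * C j + B j * C i))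
    (hu : u ∈ Submodule.span ℂ (Set.range e)) (hv : v ∈ Submodule.span ℂ (Set.range e))
    (hw : w ∈ Submodule.span ℂ (Set.range e)) : g.IIsomorphic (ofTable p c 1 b H) := by
  refine hg.iIsomorphic_ofTable H e hp
    (form_eq_table_of_le H hp fun i j hij => by rw [hform i j hij, Units.val_one, one_mul])
    (fun i j k => ?_)
    (fun x h1 h2 h3 => g.mem_center_of_form_bracket_eq_zero fun y z => ?_) hu hv hw
  · rw [hI, h, ssym3]
    simp only [hA, hB, hC]
    push_cast
    ring
  · rw [hI, ssym3, h1, h2, h3]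
    ring

/-- If the invariant vanished, every vector would be central, and isotropy of the centre would make
the form zero on a nonzero space. -/
theorem IsReduced.exists_form_bracket_ne_zero (hg : g.IsReduced) :
    ∃ x y z, g.form (g.bracket x y) z ≠ 0 := by
  by_contra! h
  have := hg.1
  obtain ⟨x, hx⟩ := exists_ne (0 : V)
  have hc : ∀ x, x ∈ g.center := fun x => g.mem_center_of_form_bracket_eq_zero (h x)
  exact hx (g.eq_zero_of_form_eq_zero fun y => hg.2 x (hc x) y (hc y))

end Frame

/-! ### Classification with one even and two odd factors. -/

section SuperCase

variable {V : Type*} [AddCommGroup V] [Module ℂ V] {g : QuadraticLieSuperalgebra V} {a b c : V}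

/-- An even vector pairing to `1` with `a` becomes isotropic after subtracting half its length times
`a`. -/
theorem exists_even_isotropic_dual (ha : a ∈ g.part 0) (ha0 : a ≠ 0) (haa : g.form a a = 0) :
    ∃ y ∈ g.part 0, g.form a y = 1 ∧ g.form y y = 0 := by
  obtain ⟨x, hx⟩ : ∃ x, g.form a x ≠ 0 := by
    by_contra! h
    exact ha0 (g.eq_zero_of_form_eq_zero h)
  have hx' : g.form a (g.evenProj x) ≠ 0 := by
    rwa [g.apply_eq_evenProj_add_oddProj (g.form a) x, g.form_even a _ ha (g.oddProj_mem x),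
      add_zero] at hx
  set y := (g.form a (g.evenProj x))⁻¹ • g.evenProj x with hy
  have hym : y ∈ g.part 0 := Submodule.smul_mem _ _ (g.evenProj_mem x)
  have hay : g.form a y = 1 := by simp [hy, hx']
  have hya : g.form y a = 1 := by rw [g.form_comm_even hym ha, hay]
  refine ⟨y - (g.form y y / 2) • a, sub_mem hym (Submodule.smul_mem _ _ ha), ?_, ?_⟩
  · simp [hay, haa]
  · simp only [map_sub, map_smul, LinearMap.sub_apply, LinearMap.smul_apply, smul_eq_mul, hay,
      hya, haa]
    ring

theorem form_oddProj_eq (hb : b ∈ g.part 1) {x : V} {s : ℂ} (hx : g.form b x = s) :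
    g.form b (g.oddProj x) = s := by
  rw [← hx, g.apply_eq_evenProj_add_oddProj (g.form b) x, g.form_odd_even hb (g.evenProj_mem x),
    zero_add]

/-- The super Jacobi identity forces the even factor of the invariant to be isotropic. -/
theorem form_self_eq_zero_of_ssym3 (ha : a ∈ g.part 0) (hb : b ∈ g.part 1) (hc : c ∈ g.part 1)
    (hb0 : b ≠ 0) (hc0 : c ≠ 0)
    (hI : ∀ x y z, g.form (g.bracket x y) z = ssym3 (g.form a) (g.form b) (g.form c) x y z) :
    g.form a a = 0 := by
  -- The factor of `c` is repeated only to fit the three-factor lemma; what is needed is a vector on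
  -- which both odd forms are nonzero.
  obtain ⟨x, hx⟩ : ∃ x, g.form b x * g.form c x * g.form c x ≠ 0 := by
    by_contra! h
    rcases eq_zero_of_mul_mul_eq_zero h with h | h | h
    · exact hb0 (g.eq_zero_of_form_eq_zero fun y => by rw [h, LinearMap.zero_apply])
    · exact hc0 (g.eq_zero_of_form_eq_zero fun y => by rw [h, LinearMap.zero_apply])
    · exact hc0 (g.eq_zero_of_form_eq_zero fun y => by rw [h, LinearMap.zero_apply])
  have hbx := form_oddProj_eq hb (rfl : g.form b x = _)
  have hcx := form_oddProj_eq hc (rfl : g.form c x = _)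
  rw [← hbx, ← hcx] at hx
  set y := g.oddProj x
  have hy : y ∈ g.part 1 := g.oddProj_mem x
  have hay : g.form a y = 0 := g.form_even a y ha hy
  have hba : g.form b a = 0 := g.form_odd_even hb ha
  have hca : g.form c a = 0 := g.form_odd_even hc ha
  have hyy : g.bracket y y = (2 * (g.form b y * g.form c y)) • a := by
    refine g.eq_of_form_eq fun z => ?_
    rw [hI, ssym3, hay, map_smul, LinearMap.smul_apply, smul_eq_mul]
    ring
  -- For odd `y` the Jacobi identity reads `3 [y, [y, y]] = 0`. Since `[y, y]` is a multiple of `a`,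
  -- pairing with `y` gives a nonzero multiple of `B(a, a)`.
  have hJ := g.jacobi 1 1 y y y hy hy
  have hS := g.bracket_skew 0 1 _ y (g.bracket_mem 1 1 y y hy hy) hy
  rw [superSign_zero_left, one_smul] at hS
  rw [superSign_one_one, hS, neg_smul, one_smul, hyy, map_smul] at hJ
  have h3 : g.form ((2 * (g.form b y * g.form c y)) • g.bracket y a) y = 0 := by
    have := congrArg (fun t => g.form t y) hJ
    simp only [map_add, map_neg, LinearMap.add_apply, LinearMap.neg_apply] at this
    linear_combination this / 3
  rw [map_smul, LinearMap.smul_apply, hI, ssym3, hay, hba, hca, smul_eq_mul] at h3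
  have hb1 : g.form b y ≠ 0 := left_ne_zero_of_mul (left_ne_zero_of_mul hx)
  have hc1 : g.form c y ≠ 0 := right_ne_zero_of_mul hx
  have h4 : (g.form b y * g.form c y) ^ 2 * g.form a a = 0 := by linear_combination -h3 / 4
  exact (mul_eq_zero.1 h4).resolve_left (pow_ne_zero 2 (mul_ne_zero hb1 hc1))

/-- A linear form vanishing on the kernel of a nonzero linear form is a multiple of it. -/
theorem eq_smul_of_ker_le {α β : Module.Dual ℂ V} {x : V} (hx : α x = 1)
    (h : ∀ y, α y = 0 → β y = 0) : β = β x • α := by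
  ext y
  have := h (y - α y • x) (by simp [hx])
  rw [map_sub, map_smul, smul_eq_mul, sub_eq_zero] at this
  rw [this, LinearMap.smul_apply, smul_eq_mul, mul_comm]

variable [FiniteDimensional ℂ V]

theorem IsReduced.iIsomorphic_gs41 (hg : g.IsReduced) (ha : a ∈ g.part 0) (hb : b ∈ g.part 1)
    (ha0 : a ≠ 0) (hb0 : b ≠ 0) (haa : g.form a a = 0)
    (hI : ∀ x y z, g.form (g.bracket x y) z = ssym3 (g.form a) (g.form b) (g.form b) x y z) :
    g.IIsomorphic gs41 := by
  obtain ⟨y, hy, hay, hyy⟩ := exists_even_isotropic_dual ha ha0 haa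
  obtain ⟨x, hx⟩ : ∃ x, g.form b x ≠ 0 := by
    by_contra! h
    exact hb0 (g.eq_zero_of_form_eq_zero h)
  obtain ⟨z, hz, hbz⟩ : ∃ z ∈ g.part 1, g.form b z = 1 :=
    ⟨_, g.oddProj_mem _, form_oddProj_eq hb (x := (g.form b x)⁻¹ • x) (by simp [hx])⟩
  have hbb := g.form_self_odd hb
  have hzz := g.form_self_odd hz
  have haz := g.form_even a z ha hz
  have hab := g.form_even a b ha hb
  have hyz := g.form_even y z hy hz
  have hyb := g.form_even y b hy hb
  have hba := g.form_odd_even hb ha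
  have hby := g.form_odd_even hb hy
  have hT : ∀ i j : Fin 4, tableFormCoeff ![0, 0, 1, 1] [(0, 1), (2, 3)] i j =
      ![![0, 1, 0, 0], ![1, 0, 0, 0], ![0, 0, 0, 1], ![0, 0, -1, 0]] i j := by
    decide
  -- The invariant gives `[z, z] = 2a`, while the table has `[Z₁, Z₁] = -2 X₀`; hence `X₀ = -a`, and
  -- `Y₀ = -y` to keep `B(X₀, Y₀) = 1`.
  refine hg.iIsomorphic_of_ssym3 hI (by constructor <;> decide +kernel) ![-a, -y, b, z]
    (fun i => ?_) (fun i j hij => ?_) ![0, -1, 0, 0] ![0, 0, 0, 1] ![0, 0, 0, 1]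
    (fun i => ?_) (fun i => ?_) (fun i => ?_) (by decide +kernel) ?_ ?_ ?_
  · fin_cases i
    exacts [neg_mem ha, neg_mem hy, hb, hz]
  · rw [hT]
    fin_cases i <;> fin_cases j <;> first | exact absurd hij (by decide) | simp [*]
  · fin_cases i <;> simp [*]
  · fin_cases i <;> simp [*]
  · fin_cases i <;> simp [*]
  · simpa using neg_mem (Submodule.subset_span (R := ℂ) (Set.mem_range_self
      (f := ![-a, -y, b, z]) 0))
  · exact Submodule.subset_span ⟨2, rfl⟩
  · exact Submodule.subset_span ⟨2, rfl⟩

theorem IsReduced.iIsomorphic_gs42 (hg : g.IsReduced) (ha : a ∈ g.part 0) (hb : b ∈ g.part 1)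
    (hc : c ∈ g.part 1) (ha0 : a ≠ 0) (haa : g.form a a = 0) (hbc : g.form b c = 1)
    (hI : ∀ x y z, g.form (g.bracket x y) z = ssym3 (g.form a) (g.form b) (g.form c) x y z) :
    g.IIsomorphic gs42 := by
  obtain ⟨y, hy, hay, hyy⟩ := exists_even_isotropic_dual ha ha0 haa
  have hbb := g.form_self_odd hb
  have hcc := g.form_self_odd hc
  have hcb : g.form c b = -1 := by rw [g.form_comm_odd hc hb, hbc]
  have hac := g.form_even a c ha hc
  have hab := g.form_even a b ha hb
  have hyc := g.form_even y c hy hc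
  have hyb := g.form_even y b hy hb
  have hba := g.form_odd_even hb ha
  have hby := g.form_odd_even hb hy
  have hca := g.form_odd_even hc ha
  have hcy := g.form_odd_even hc hy
  have hT : ∀ i j : Fin 4, tableFormCoeff ![0, 0, 1, 1] [(0, 1), (2, 3)] i j =
      ![![0, 1, 0, 0], ![1, 0, 0, 0], ![0, 0, 0, 1], ![0, 0, -1, 0]] i j := by
    decide
  -- The form is alternating on the odd part, so `c, -b` is the pair with product `1` on which the
  -- forms of `b` and `c` are the coordinates.
  refine hg.iIsomorphic_of_ssym3 hI (by constructor <;> decide +kernel) ![a, y, c, -b]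
    (fun i => ?_) (fun i j hij => ?_) ![0, 1, 0, 0] ![0, 0, 1, 0] ![0, 0, 0, 1]
    (fun i => ?_) (fun i => ?_) (fun i => ?_) (by decide +kernel) ?_ ?_ ?_
  · fin_cases i
    exacts [ha, hy, hc, neg_mem hb]
  · rw [hT]
    fin_cases i <;> fin_cases j <;> first | exact absurd hij (by decide) | simp [*]
  · fin_cases i <;> simp [*]
  · fin_cases i <;> simp [*]
  · fin_cases i <;> simp [*]
  · exact Submodule.subset_span ⟨0, rfl⟩
  · simpa using neg_mem (Submodule.subset_span (R := ℂ) (Set.mem_range_self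
      (f := ![a, y, c, -b]) 3))
  · exact Submodule.subset_span ⟨2, rfl⟩

theorem IsReduced.iIsomorphic_gs6 (hg : g.IsReduced) (ha : a ∈ g.part 0) (hb : b ∈ g.part 1)
    (hc : c ∈ g.part 1) (ha0 : a ≠ 0) (haa : g.form a a = 0) (hbc : g.form b c = 0) {z t : V}
    (hz : z ∈ g.part 1) (ht : t ∈ g.part 1) (hbz : g.form b z = 1) (hbt : g.form b t = 0)
    (hcz : g.form c z = 0) (hct : g.form c t = 1) (hzt : g.form z t = 0)
    (hI : ∀ x y z, g.form (g.bracket x y) z = ssym3 (g.form a) (g.form b) (g.form c) x y z) :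
    g.IIsomorphic gs6 := by
  obtain ⟨y, hy, hay, hyy⟩ := exists_even_isotropic_dual ha ha0 haa
  have hbb := g.form_self_odd hb
  have hcc := g.form_self_odd hc
  have hzz := g.form_self_odd hz
  have htt := g.form_self_odd ht
  have hcb : g.form c b = 0 := by rw [g.form_comm_odd hc hb, hbc, neg_zero]
  have hae := fun s hs => g.form_even a s ha hs
  have hye := fun s hs => g.form_even y s hy hs
  have hba := g.form_odd_even hb ha
  have hby := g.form_odd_even hb hy
  have hca := g.form_odd_even hc ha
  have hcy := g.form_odd_even hc hy
  have hT : ∀ i j : Fin 6, tableFormCoeff ![0, 0, 1, 1, 1, 1] [(0, 1), (2, 4), (3, 5)] i j =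
      ![![0, 1, 0, 0, 0, 0], ![1, 0, 0, 0, 0, 0], ![0, 0, 0, 0, 1, 0], ![0, 0, 0, 0, 0, 1],
        ![0, 0, -1, 0, 0, 0], ![0, 0, 0, -1, 0, 0]] i j := by
    decide
  refine hg.iIsomorphic_of_ssym3 hI (by constructor <;> decide +kernel) ![-a, -y, b, c, z, t]
    (fun i => ?_) (fun i j hij => ?_) ![0, -1, 0, 0, 0, 0] ![0, 0, 0, 0, 1, 0]
    ![0, 0, 0, 0, 0, 1] (fun i => ?_) (fun i => ?_) (fun i => ?_) (by decide +kernel) ?_ ?_ ?_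
  · fin_cases i
    exacts [neg_mem ha, neg_mem hy, hb, hc, hz, ht]
  · rw [hT]
    fin_cases i <;> fin_cases j <;> first | exact absurd hij (by decide) | simp [*]
  · fin_cases i <;> simp [*]
  · fin_cases i <;> simp [*]
  · fin_cases i <;> simp [*]
  · simpa using neg_mem (Submodule.subset_span (R := ℂ) (Set.mem_range_self
      (f := ![-a, -y, b, c, z, t]) 0))
  · exact Submodule.subset_span ⟨2, rfl⟩
  · exact Submodule.subset_span ⟨3, rfl⟩

theorem IsReduced.exists_superModel (hg : g.IsReduced) {α β γ : Module.Dual ℂ V}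
    (hα : ∀ x ∈ g.part 1, α x = 0) (hβγ : ∀ x ∈ g.part 0, β x = 0 ∧ γ x = 0)
    (hI : ∀ x y z, g.form (g.bracket x y) z = ssym3 α β γ x y z) :
    ∃ m : SuperModel, g.IIsomorphic m.algebra := by
  obtain ⟨a, rfl⟩ := g.exists_form_eq α
  obtain ⟨b, rfl⟩ := g.exists_form_eq β
  obtain ⟨c, rfl⟩ := g.exists_form_eq γ
  have ha := g.mem_even_of_form_eq_zero hα
  have hb := g.mem_odd_of_form_eq_zero fun x hx => (hβγ x hx).1
  have hc := g.mem_odd_of_form_eq_zero fun x hx => (hβγ x hx).2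
  obtain ⟨x₁, x₂, x₃, hne⟩ := hg.exists_form_bracket_ne_zero
  rw [hI] at hne
  have ha0 : a ≠ 0 := by rintro rfl; simp [ssym3] at hne
  have hb0 : b ≠ 0 := by rintro rfl; simp [ssym3] at hne
  have hc0 : c ≠ 0 := by rintro rfl; simp [ssym3] at hne
  have haa := form_self_eq_zero_of_ssym3 ha hb hc hb0 hc0 hI
  by_cases hbc : g.form b c = 0
  · obtain ⟨x, hx⟩ : ∃ x, g.form b x ≠ 0 := by
      by_contra! h
      exact hb0 (g.eq_zero_of_form_eq_zero h)
    have hbx : g.form b ((g.form b x)⁻¹ • x) = 1 := by simp [hx]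
    set x' := (g.form b x)⁻¹ • x
    by_cases hker : ∀ y, g.form b y = 0 → g.form c y = 0
    · have hcb := eq_smul_of_ker_le hbx hker
      set k := g.form c x'
      have hk : k ≠ 0 := by
        intro hk
        rw [hk, zero_smul] at hcb
        exact hc0 (g.eq_zero_of_form_eq_zero fun y => by rw [hcb, LinearMap.zero_apply])
      -- Here `c = k b`, and the factor `k` is moved to `a`.
      refine ⟨.gs41, hg.iIsomorphic_gs41 (a := k • a) (b := b) (Submodule.smul_mem _ _ ha) hb
        (smul_ne_zero hk ha0) hb0 (by simp [haa]) fun x y z => ?_⟩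
      rw [hI, hcb]
      simp only [ssym3, map_smul, LinearMap.smul_apply, smul_eq_mul]
      ring
    · push Not at hker
      obtain ⟨y, hby, hcy⟩ := hker
      have hct : g.form c ((g.form c y)⁻¹ • y) = 1 := by simp [hcy]
      have hbt : g.form b ((g.form c y)⁻¹ • y) = 0 := by simp [hby]
      set t := (g.form c y)⁻¹ • y
      -- The pair `z, t` is made dual to `b, c`. Passing to odd components does not affect pairings
      -- with odd vectors.
      have hbz : g.form b (x' - g.form c x' • t) = 1 := by simp [hbx, hbt]
      have hcz : g.form c (x' - g.form c x' • t) = 0 := by simp [hct]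
      have hcb : g.form c b = 0 := by rw [g.form_comm_odd hc hb, hbc, neg_zero]
      have hz := g.oddProj_mem (x' - g.form c x' • t)
      replace hbz := form_oddProj_eq hb hbz
      replace hcz := form_oddProj_eq hc hcz
      set z := g.oddProj (x' - g.form c x' • t)
      have ht := g.oddProj_mem t
      replace hbt := form_oddProj_eq hb hbt
      replace hct := form_oddProj_eq hc hct
      set t' := g.oddProj t
      have hzb : g.form z b = -1 := by rw [g.form_comm_odd hz hb, hbz]
      -- Adding `B(z, t') b` makes the second dual vector orthogonal to `z`, because `B(z, b) = -1`.
      -- Its pairings with `b` and `c` are unchanged, because `B(b, b) = B(c, b) = 0`.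
      exact ⟨.gs6, hg.iIsomorphic_gs6 ha hb hc ha0 haa hbc (z := z)
        (t := t' + g.form z t' • b) hz (add_mem ht (Submodule.smul_mem _ _ hb)) hbz
        (by simp [hbt, g.form_self_odd hb]) hcz (by simp [hct, hcb]) (by simp [hzb]) hI⟩
  · set k := g.form b c
    -- Rescaling `b` normalises `B(b, c)` to `1`; `a` takes the inverse factor.
    refine ⟨.gs42, hg.iIsomorphic_gs42 (a := k • a) (b := k⁻¹ • b) (c := c)
      (Submodule.smul_mem _ _ ha) (Submodule.smul_mem _ _ hb) hc (smul_ne_zero hbc ha0)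
      (by simp [haa]) (by simp [k, hbc]) fun x y z => ?_⟩
    rw [hI]
    simp only [ssym3, map_smul, LinearMap.smul_apply, smul_eq_mul]
    field_simp

end SuperCase

end QuadraticLieSuperalgebra

namespace QuadraticLieSuperalgebra

/-! ### Classification with three even factors. -/

section LieCase

variable {V : Type*} [AddCommGroup V] [Module ℂ V] {g : QuadraticLieSuperalgebra V}

/-- The invariant of `g` is the multiple `c` of the product of the linear forms represented by the
pairwise orthogonal vectors `u, v, w`. -/
structure IsOrthogonalFactorization (g : QuadraticLieSuperalgebra V) (c : ℂ) (u v w : V) :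
    Prop where
  ne_zero : c ≠ 0
  orth₁₂ : g.form u v = 0
  orth₁₃ : g.form u w = 0
  orth₂₃ : g.form v w = 0
  eq_det3 : ∀ x y z, g.form (g.bracket x y) z =
    c * det3 (g.form u) (g.form v) (g.form w) x y z

variable {c : ℂ} {u v w : V}

/-- The product of three even forms is invariant under cyclic permutation. With three lengths in
`{0, 1}`, rotations suffice to put the unit vectors first. -/
theorem IsOrthogonalFactorization.rotate (h : g.IsOrthogonalFactorization c u v w)
    (hsym : ∀ x y, g.form x y = g.form y x) : g.IsOrthogonalFactorization c v w u where
  ne_zero := h.ne_zero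
  orth₁₂ := h.orth₂₃
  orth₁₃ := by rw [hsym, h.orth₁₂]
  orth₂₃ := by rw [hsym, h.orth₁₃]
  eq_det3 x y z := by
    rw [h.eq_det3]
    simp only [det3]
    ring

theorem IsOrthogonalFactorization.exists_dual (h : g.IsOrthogonalFactorization c u v w)
    (hg : g.IsReduced) (p q s : ℂ) :
    ∃ x, g.form u x = p ∧ g.form v x = q ∧ g.form w x = s := by
  obtain ⟨x, y, z, hne⟩ := hg.exists_form_bracket_ne_zero
  rw [h.eq_det3] at hne
  have hD := right_ne_zero_of_mul hne
  obtain ⟨D, hDe⟩ : ∃ D, D = det3 (g.form u) (g.form v) (g.form w) x y z := ⟨_, rfl⟩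
  rw [← hDe] at hD
  rw [det3] at hDe
  -- Cramer's rule: the invariant is nonzero at some `x, y, z`, and the coefficients are cofactors
  -- of the values of the three forms there.
  refine ⟨D⁻¹ • ((p * (g.form v y * g.form w z - g.form v z * g.form w y)
      - q * (g.form u y * g.form w z - g.form u z * g.form w y)
      + s * (g.form u y * g.form v z - g.form u z * g.form v y)) • x
    + (-p * (g.form v x * g.form w z - g.form v z * g.form w x)
      + q * (g.form u x * g.form w z - g.form u z * g.form w x)
      - s * (g.form u x * g.form v z - g.form u z * g.form v x)) • y
    + (p * (g.form v x * g.form w y - g.form v y * g.form w x)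
      - q * (g.form u x * g.form w y - g.form u y * g.form w x)
      + s * (g.form u x * g.form v y - g.form u y * g.form v x)) • z), ?_, ?_, ?_⟩ <;>
  · simp only [map_add, map_smul, smul_eq_mul]
    rw [inv_mul_eq_iff_eq_mul₀ hD, hDe]
    ring

theorem exists_scaling (d : ℂ) : ∃ t : ℂ, t ≠ 0 ∧ (t * t * d = 0 ∨ t * t * d = 1) := by
  by_cases hd : d = 0
  · exact ⟨1, one_ne_zero, .inl (by simp [hd])⟩
  · obtain ⟨s, hs⟩ := IsAlgClosed.exists_eq_mul_self d
    have hs0 : s ≠ 0 := by rintro rfl; simp at hs; exact hd hs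
    exact ⟨s⁻¹, inv_ne_zero hs0, .inr (by rw [hs]; field_simp)⟩

/-- The factors of a decomposable invariant can be chosen orthogonal, of length `0` or `1`. -/
theorem exists_isOrthogonalFactorization (hsym : ∀ x y, g.form x y = g.form y x)
    {a b c : V}
    (hI : ∀ x y z, g.form (g.bracket x y) z = det3 (g.form a) (g.form b) (g.form c) x y z) :
    ∃ k u v w, g.IsOrthogonalFactorization k u v w ∧ (g.form u u = 0 ∨ g.form u u = 1) ∧
      (g.form v v = 0 ∨ g.form v v = 1) ∧ (g.form w w = 0 ∨ g.form w w = 1) := by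
  let φ : (Fin 3 → ℂ) →ₗ[ℂ] V := Fintype.linearCombination ℂ ![a, b, c]
  have hφ : ∀ s, φ s = s 0 • a + s 1 • b + s 2 • c := fun s => by
    simp [φ, Fintype.linearCombination_apply, Fin.sum_univ_three]
  -- The form is pulled back to the coefficient space `ℂ³`, so no independence of `a, b, c` is
  -- needed and `G` may be degenerate. A change of basis multiplies the product of the forms by its
  -- determinant, which goes into the scalar `k`.
  let G : LinearMap.BilinForm ℂ (Fin 3 → ℂ) := g.form.compl₁₂ φ φ
  have hG : LinearMap.IsSymm G := ⟨fun s t => hsym _ _⟩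
  obtain ⟨e₀, he₀⟩ := LinearMap.BilinForm.exists_orthogonal_basis hG
  have hdim : Module.finrank ℂ (Fin 3 → ℂ) = 3 := by simp
  let e := e₀.reindex (finCongr hdim)
  have he : ∀ i j, i ≠ j → g.form (φ (e i)) (φ (e j)) = 0 := fun i j hij => by
    simp only [e, Module.Basis.reindex_apply]
    exact he₀ (by simpa using hij)
  let P : Matrix (Fin 3) (Fin 3) ℂ := Matrix.of fun i => e i
  have hP : P.det ≠ 0 := by
    have : IsUnit P := Matrix.linearIndependent_rows_iff_isUnit.1 e.linearIndependent
    exact ((Matrix.isUnit_iff_isUnit_det P).1 this).ne_zero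
  have hdet : ∀ x y z, det3 (g.form (φ (e 0))) (g.form (φ (e 1))) (g.form (φ (e 2))) x y z =
      P.det * det3 (g.form a) (g.form b) (g.form c) x y z := by
    intro x y z
    rw [Matrix.det_fin_three]
    simp only [det3, hφ, map_add, map_smul, LinearMap.add_apply, LinearMap.smul_apply,
      smul_eq_mul, P, Matrix.of_apply]
    ring
  obtain ⟨t₀, h0, hd0⟩ := exists_scaling (g.form (φ (e 0)) (φ (e 0)))
  obtain ⟨t₁, h1, hd1⟩ := exists_scaling (g.form (φ (e 1)) (φ (e 1)))
  obtain ⟨t₂, h2, hd2⟩ := exists_scaling (g.form (φ (e 2)) (φ (e 2)))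
  refine ⟨(t₀ * t₁ * t₂ * P.det)⁻¹, t₀ • φ (e 0), t₁ • φ (e 1), t₂ • φ (e 2),
    ⟨inv_ne_zero (mul_ne_zero (mul_ne_zero (mul_ne_zero h0 h1) h2) hP), ?_, ?_, ?_,
      fun x y z => ?_⟩, ?_, ?_, ?_⟩
  · simp [he 0 1 (by decide)]
  · simp [he 0 2 (by decide)]
  · simp [he 1 2 (by decide)]
  · rw [hI, eq_inv_mul_iff_mul_eq₀ (mul_ne_zero (mul_ne_zero (mul_ne_zero h0 h1) h2) hP),
      mul_assoc, ← hdet]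
    simp only [det3, map_smul, LinearMap.smul_apply, smul_eq_mul]
    ring
  all_goals
    simp only [map_smul, LinearMap.smul_apply, smul_eq_mul, ← mul_assoc]
    assumption

variable [FiniteDimensional ℂ V]

/-- No isotropic factor is available to absorb `c`. Scaling the frame by `c⁻¹` and the factors by
`c` keeps them dual and turns the coefficient into `c = c⁻² c³`, so the parameter is `c⁻²`. -/
theorem IsOrthogonalFactorization.iIsomorphic_g3 (h : g.IsOrthogonalFactorization c u v w)
    (hg : g.IsReduced) (heven : ∀ x, x ∈ g.part 0) (hu : g.form u u = 1) (hv : g.form v v = 1)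
    (hw : g.form w w = 1) : ∃ r, g.IIsomorphic (g3 r) := by
  have hsym := fun x y => g.form_comm_even (heven x) (heven y)
  have hc := h.ne_zero
  have huv := h.orth₁₂
  have huw := h.orth₁₃
  have hvw := h.orth₂₃
  have hvu : g.form v u = 0 := by rw [hsym, huv]
  have hwu : g.form w u = 0 := by rw [hsym, huw]
  have hwv : g.form w v = 0 := by rw [hsym, hvw]
  have hT : ∀ i j : Fin 3, tableFormCoeff ![0, 0, 0] [(0, 0), (1, 1), (2, 2)] i j =
      ![![1, 0, 0], ![0, 1, 0], ![0, 0, 1]] i j := by decide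
  have hmem : ∀ i, c • ![u, v, w] i ∈ Submodule.span ℂ (Set.range fun i => c⁻¹ • ![u, v, w] i) := by
    intro i
    have : c • ![u, v, w] i = (c * c) • (c⁻¹ • ![u, v, w] i) := by
      rw [smul_smul, mul_assoc, mul_inv_cancel₀ hc, mul_one]
    rw [this]
    exact Submodule.smul_mem _ _ (Submodule.subset_span ⟨i, rfl⟩)
  refine ⟨(Units.mk0 c hc)⁻¹ ^ 2, hg.iIsomorphic_of_det3 (u := c • u) (v := c • v) (w := c • w)
    (fun x y z => ?_) (by constructor <;> decide +kernel) (fun i => c⁻¹ • ![u, v, w] i)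
    (fun i => ?_) (fun i j _ => ?_) ![1, 0, 0] ![0, 1, 0] ![0, 0, 1]
    (fun i => ?_) (fun i => ?_) (fun i => ?_) (by decide +kernel) (hmem 0) (hmem 1) (hmem 2)⟩
  · rw [h.eq_det3]
    simp only [det3, map_smul, LinearMap.smul_apply, smul_eq_mul, Units.val_pow_eq_pow_val,
      Units.val_inv_eq_inv_val, Units.val_mk0]
    field_simp
  · fin_cases i <;> exact heven _
  · rw [hT]
    fin_cases i <;> fin_cases j <;> simp [*] <;> ring
  · fin_cases i <;> simp [*]
  · fin_cases i <;> simp [*]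
  · fin_cases i <;> simp [*]

theorem IsOrthogonalFactorization.iIsomorphic_g4 (h : g.IsOrthogonalFactorization c u v w)
    (hg : g.IsReduced) (heven : ∀ x, x ∈ g.part 0) (hu : g.form u u = 1) (hv : g.form v v = 1)
    (hw : g.form w w = 0) : g.IIsomorphic g4 := by
  have hsym := fun x y => g.form_comm_even (heven x) (heven y)
  have hc := h.ne_zero
  have huv := h.orth₁₂
  have huw := h.orth₁₃
  have hvw := h.orth₂₃
  have hvu : g.form v u = 0 := by rw [hsym, huv]
  have hwu : g.form w u = 0 := by rw [hsym, huw]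
  have hwv : g.form w v = 0 := by rw [hsym, hvw]
  obtain ⟨x₀, hux, hvx, hwx⟩ := h.exists_dual hg 0 0 (-(Complex.I * c))⁻¹
  -- The orthonormal pair `u, v` is traded for a hyperbolic pair `P, Q`. As `Q ∧ P = i u ∧ v`, the
  -- multiple `Z = -i c w` gives `Z ∧ Q ∧ P = c u ∧ v ∧ w`.
  obtain ⟨P, hP⟩ : ∃ P, P = u + Complex.I • v := ⟨_, rfl⟩
  obtain ⟨Q, hQ⟩ : ∃ Q, Q = (1 / 2 : ℂ) • (u - Complex.I • v) := ⟨_, rfl⟩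
  obtain ⟨Z, hZ⟩ : ∃ Z, Z = (-(Complex.I * c)) • w := ⟨_, rfl⟩
  have hI := Complex.I_mul_I
  have hk : -(Complex.I * c) ≠ 0 := neg_ne_zero.2 (mul_ne_zero Complex.I_ne_zero hc)
  have hZx₀ : g.form Z x₀ = 1 := by
    rw [hZ, map_smul, LinearMap.smul_apply, hwx, smul_eq_mul, mul_inv_cancel₀ hk]
  have hx₀Z : g.form x₀ Z = 1 := by rw [hsym, hZx₀]
  have hZZ : g.form Z Z = 0 := by simp [hZ, hw]
  -- `x₀` is dual to `Z` and orthogonal to `P` and `Q`; the multiple of `Z` makes it isotropic.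
  obtain ⟨X, hX⟩ : ∃ X, X = x₀ - (g.form x₀ x₀ / 2) • Z := ⟨_, rfl⟩
  have hPP : g.form P P = 0 := by simp [hP, hu, hv, huv, hvu]
  have hPQ : g.form P Q = 1 := by
    simp [hP, hQ, hu, hv, huv, hvu]; norm_num
  have hQQ : g.form Q Q = 0 := by simp [hQ, hu, hv, huv, hvu]
  have hQP : g.form Q P = 1 := by rw [hsym, hPQ]
  have hPZ : g.form P Z = 0 := by simp [hP, hZ, huw, hvw]
  have hQZ : g.form Q Z = 0 := by simp [hQ, hZ, huw, hvw]
  have hZP : g.form Z P = 0 := by rw [hsym, hPZ]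
  have hZQ : g.form Z Q = 0 := by rw [hsym, hQZ]
  have hZX : g.form Z X = 1 := by simp [hX, hZx₀, hZZ]
  have hXZ : g.form X Z = 1 := by rw [hsym, hZX]
  have hXX : g.form X X = 0 := by simp [hX, hZx₀, hx₀Z, hZZ]; ring
  have hPX : g.form P X = 0 := by simp [hX, hPZ]; simp [hP, hux, hvx]
  have hQX : g.form Q X = 0 := by simp [hX, hQZ]; simp [hQ, hux, hvx]
  have hXP : g.form X P = 0 := by rw [hsym, hPX]
  have hXQ : g.form X Q = 0 := by rw [hsym, hQX]
  have hT : ∀ i j : Fin 4, tableFormCoeff ![0, 0, 0, 0] [(0, 3), (1, 2)] i j =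
      ![![0, 0, 0, 1], ![0, 0, 1, 0], ![0, 1, 0, 0], ![1, 0, 0, 0]] i j := by decide
  refine hg.iIsomorphic_of_det3 (u := Z) (v := Q) (w := P) (r := 1)
    (fun x y z => ?_) (by constructor <;> decide +kernel) ![X, P, Q, Z]
    (fun i => ?_) (fun i j _ => ?_) ![1, 0, 0, 0] ![0, 1, 0, 0] ![0, 0, 1, 0]
    (fun i => ?_) (fun i => ?_) (fun i => ?_) (by decide +kernel)
    (Submodule.subset_span ⟨3, rfl⟩) (Submodule.subset_span ⟨2, rfl⟩)
    (Submodule.subset_span ⟨1, rfl⟩)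
  · rw [h.eq_det3]
    simp only [det3, hP, hQ, hZ, map_smul, map_add, map_sub, LinearMap.add_apply,
      LinearMap.sub_apply, LinearMap.smul_apply, smul_eq_mul, Units.val_one]
    linear_combination (norm := (simp only [det3]; ring))
      (c * det3 (g.form u) (g.form v) (g.form w) x y z) * hI
  · fin_cases i <;> exact heven _
  · rw [hT]
    -- Without the defining equations, `simp` works from the recorded pairings alone and does not
    -- unfold the frame.
    clear hX hP hQ hZ
    fin_cases i <;> fin_cases j <;> simp [*]
  all_goals
    clear hX hP hQ hZ
    fin_cases i <;> simp [*]

theorem IsOrthogonalFactorization.iIsomorphic_g5 (h : g.IsOrthogonalFactorization c u v w)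
    (hg : g.IsReduced) (heven : ∀ x, x ∈ g.part 0) (hu : g.form u u = 1) (hv : g.form v v = 0)
    (hw : g.form w w = 0) : g.IIsomorphic g5 := by
  have hsym := fun x y => g.form_comm_even (heven x) (heven y)
  have hc := h.ne_zero
  have huw := h.orth₁₃
  have hwu : g.form w u = 0 := by rw [hsym, huw]
  obtain ⟨Z, hZ⟩ : ∃ Z, Z = c • v := ⟨_, rfl⟩
  have huZ : g.form u Z = 0 := by simp [hZ, h.orth₁₂]
  have hZu : g.form Z u = 0 := by rw [hsym, huZ]
  have hZw : g.form Z w = 0 := by simp [hZ, h.orth₂₃]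
  have hwZ : g.form w Z = 0 := by rw [hsym, hZw]
  have hZZ : g.form Z Z = 0 := by simp [hZ, hv]
  obtain ⟨x₀, hux₀, hvx₀, hwx₀⟩ := h.exists_dual hg 0 c⁻¹ 0
  have hZx₀ : g.form Z x₀ = 1 := by simp [hZ, hvx₀, hc]
  have hx₀Z : g.form x₀ Z = 1 := by rw [hsym, hZx₀]
  obtain ⟨X, hX⟩ : ∃ X, X = x₀ - (g.form x₀ x₀ / 2) • Z := ⟨_, rfl⟩
  have hXX : g.form X X = 0 := by simp [hX, hZx₀, hx₀Z, hZZ]; ring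
  have huX : g.form u X = 0 := by simp [hX, huZ, hux₀]
  have hZX : g.form Z X = 1 := by simp [hX, hZZ, hZx₀]
  have hwX : g.form w X = 0 := by simp [hX, hwZ, hwx₀]
  have hXu : g.form X u = 0 := by rw [hsym, huX]
  have hXZ : g.form X Z = 1 := by rw [hsym, hZX]
  have hXw : g.form X w = 0 := by rw [hsym, hwX]
  obtain ⟨y₀, huy₀, hvy₀, hwy₀⟩ := h.exists_dual hg 0 0 1
  have hZy₀ : g.form Z y₀ = 0 := by simp [hZ, hvy₀]
  have hy₀Z : g.form y₀ Z = 0 := by rw [hsym, hZy₀]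
  have hy₀w : g.form y₀ w = 1 := by rw [hsym, hwy₀]
  -- The multiple of `w` makes `Y` isotropic and the multiple of `Z` makes it orthogonal to `X`;
  -- neither disturbs the other pairings, as `Z` and `w` are isotropic and orthogonal.
  obtain ⟨Y, hY⟩ : ∃ Y, Y = y₀ - (g.form y₀ y₀ / 2) • w - g.form X y₀ • Z := ⟨_, rfl⟩
  have hYY : g.form Y Y = 0 := by
    simp [hY, hy₀Z, hZy₀, hy₀w, hwy₀, hZZ, hw, hZw, hwZ]; ring
  have hXY : g.form X Y = 0 := by simp [hY, hXw, hXZ]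
  have huY : g.form u Y = 0 := by simp [hY, huy₀, huw, huZ]
  have hZY : g.form Z Y = 0 := by simp [hY, hZy₀, hZw, hZZ]
  have hwY : g.form w Y = 1 := by simp [hY, hwy₀, hw, hwZ]
  have hYX : g.form Y X = 0 := by rw [hsym, hXY]
  have hYu : g.form Y u = 0 := by rw [hsym, huY]
  have hYZ : g.form Y Z = 0 := by rw [hsym, hZY]
  have hYw : g.form Y w = 1 := by rw [hsym, hwY]
  have hT : ∀ i j : Fin 5, tableFormCoeff ![0, 0, 0, 0, 0] [(0, 3), (1, 4), (2, 2)] i j =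
      ![![0, 0, 0, 1, 0], ![0, 0, 0, 0, 1], ![0, 0, 1, 0, 0], ![1, 0, 0, 0, 0],
        ![0, 1, 0, 0, 0]] i j := by decide
  refine hg.iIsomorphic_of_det3 (u := Z) (v := w) (w := u) (r := 1)
    (fun x y z => ?_) (by constructor <;> decide +kernel) ![X, Y, u, Z, w]
    (fun i => ?_) (fun i j _ => ?_) ![1, 0, 0, 0, 0] ![0, 1, 0, 0, 0] ![0, 0, 1, 0, 0]
    (fun i => ?_) (fun i => ?_) (fun i => ?_) (by decide +kernel)
    (Submodule.subset_span ⟨3, rfl⟩) (Submodule.subset_span ⟨4, rfl⟩)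
    (Submodule.subset_span ⟨2, rfl⟩)
  · rw [h.eq_det3]
    simp only [det3, hZ, map_smul, LinearMap.smul_apply, smul_eq_mul, Units.val_one]
    ring
  · fin_cases i <;> exact heven _
  · rw [hT]
    clear hX hY hZ
    fin_cases i <;> fin_cases j <;> simp [*]
  all_goals
    clear hX hY hZ
    fin_cases i <;> simp [*]

/-- The factors span a totally isotropic space. An isotropic dual frame `X, Y, T` is built one
vector at a time, each corrected by multiples of the factors. -/
theorem IsOrthogonalFactorization.iIsomorphic_g6 (h : g.IsOrthogonalFactorization c u v w)
    (hg : g.IsReduced) (heven : ∀ x, x ∈ g.part 0) (hu : g.form u u = 0) (hv : g.form v v = 0)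
    (hw : g.form w w = 0) : g.IIsomorphic g6 := by
  have hsym := fun x y => g.form_comm_even (heven x) (heven y)
  have hc := h.ne_zero
  have hvw := h.orth₂₃
  have hwv : g.form w v = 0 := by rw [hsym, hvw]
  obtain ⟨Z, hZ⟩ : ∃ Z, Z = c • u := ⟨_, rfl⟩
  have hZv : g.form Z v = 0 := by simp [hZ, h.orth₁₂]
  have hvZ : g.form v Z = 0 := by rw [hsym, hZv]
  have hZw : g.form Z w = 0 := by simp [hZ, h.orth₁₃]
  have hwZ : g.form w Z = 0 := by rw [hsym, hZw]
  have hZZ : g.form Z Z = 0 := by simp [hZ, hu]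
  obtain ⟨x₀, hux₀, hvx₀, hwx₀⟩ := h.exists_dual hg c⁻¹ 0 0
  have hZx₀ : g.form Z x₀ = 1 := by simp [hZ, hux₀, hc]
  have hx₀Z : g.form x₀ Z = 1 := by rw [hsym, hZx₀]
  obtain ⟨X, hX⟩ : ∃ X, X = x₀ - (g.form x₀ x₀ / 2) • Z := ⟨_, rfl⟩
  have hXX : g.form X X = 0 := by simp [hX, hZx₀, hx₀Z, hZZ]; ring
  have hZX : g.form Z X = 1 := by simp [hX, hZZ, hZx₀]
  have hvX : g.form v X = 0 := by simp [hX, hvZ, hvx₀]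
  have hwX : g.form w X = 0 := by simp [hX, hwZ, hwx₀]
  have hXZ : g.form X Z = 1 := by rw [hsym, hZX]
  have hXv : g.form X v = 0 := by rw [hsym, hvX]
  have hXw : g.form X w = 0 := by rw [hsym, hwX]
  obtain ⟨y₀, huy₀, hvy₀, hwy₀⟩ := h.exists_dual hg 0 1 0
  have hZy₀ : g.form Z y₀ = 0 := by simp [hZ, huy₀]
  have hy₀Z : g.form y₀ Z = 0 := by rw [hsym, hZy₀]
  have hy₀v : g.form y₀ v = 1 := by rw [hsym, hvy₀]
  obtain ⟨Y, hY⟩ : ∃ Y, Y = y₀ - (g.form y₀ y₀ / 2) • v - g.form X y₀ • Z := ⟨_, rfl⟩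
  have hYY : g.form Y Y = 0 := by
    simp [hY, hy₀Z, hZy₀, hy₀v, hvy₀, hZZ, hv, hZv, hvZ]; ring
  have hXY : g.form X Y = 0 := by simp [hY, hXv, hXZ]
  have hZY : g.form Z Y = 0 := by simp [hY, hZy₀, hZv, hZZ]
  have hvY : g.form v Y = 1 := by simp [hY, hvy₀, hv, hvZ]
  have hwY : g.form w Y = 0 := by simp [hY, hwy₀, hwv, hwZ]
  have hYX : g.form Y X = 0 := by rw [hsym, hXY]
  have hYZ : g.form Y Z = 0 := by rw [hsym, hZY]
  have hYv : g.form Y v = 1 := by rw [hsym, hvY]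
  have hYw : g.form Y w = 0 := by rw [hsym, hwY]
  obtain ⟨t₀, hut₀, hvt₀, hwt₀⟩ := h.exists_dual hg 0 0 1
  have hZt₀ : g.form Z t₀ = 0 := by simp [hZ, hut₀]
  have ht₀Z : g.form t₀ Z = 0 := by rw [hsym, hZt₀]
  have ht₀v : g.form t₀ v = 0 := by rw [hsym, hvt₀]
  have ht₀w : g.form t₀ w = 1 := by rw [hsym, hwt₀]
  obtain ⟨T, hT⟩ : ∃ T, T = t₀ - (g.form t₀ t₀ / 2) • w - g.form X t₀ • Z - g.form Y t₀ • v :=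
    ⟨_, rfl⟩
  have hTT : g.form T T = 0 := by
    simp [hT, ht₀Z, hZt₀, ht₀v, hvt₀, ht₀w, hwt₀, hZZ, hv, hw, hZv, hvZ, hZw, hwZ, hvw, hwv]; ring
  have hXT : g.form X T = 0 := by simp [hT, hXv, hXw, hXZ]
  have hYT : g.form Y T = 0 := by simp [hT, hYv, hYw, hYZ]
  have hZT : g.form Z T = 0 := by simp [hT, hZt₀, hZv, hZw, hZZ]
  have hvT : g.form v T = 0 := by simp [hT, hvt₀, hv, hvw, hvZ]
  have hwT : g.form w T = 1 := by simp [hT, hwt₀, hwv, hw, hwZ]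
  have hTX : g.form T X = 0 := by rw [hsym, hXT]
  have hTY : g.form T Y = 0 := by rw [hsym, hYT]
  have hTZ : g.form T Z = 0 := by rw [hsym, hZT]
  have hTv : g.form T v = 0 := by rw [hsym, hvT]
  have hTw : g.form T w = 1 := by rw [hsym, hwT]
  have hB : ∀ i j : Fin 6, tableFormCoeff ![0, 0, 0, 0, 0, 0] [(0, 3), (1, 4), (2, 5)] i j =
      ![![0, 0, 0, 1, 0, 0], ![0, 0, 0, 0, 1, 0], ![0, 0, 0, 0, 0, 1], ![1, 0, 0, 0, 0, 0],
        ![0, 1, 0, 0, 0, 0], ![0, 0, 1, 0, 0, 0]] i j := by decide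
  refine hg.iIsomorphic_of_det3 (u := Z) (v := v) (w := w) (r := 1)
    (fun x y z => ?_) (by constructor <;> decide +kernel) ![X, Y, T, Z, v, w]
    (fun i => ?_) (fun i j _ => ?_) ![1, 0, 0, 0, 0, 0] ![0, 1, 0, 0, 0, 0] ![0, 0, 1, 0, 0, 0]
    (fun i => ?_) (fun i => ?_) (fun i => ?_) (by decide +kernel)
    (Submodule.subset_span ⟨3, rfl⟩) (Submodule.subset_span ⟨4, rfl⟩)
    (Submodule.subset_span ⟨5, rfl⟩)
  · rw [h.eq_det3]
    simp only [det3, hZ, map_smul, LinearMap.smul_apply, smul_eq_mul, Units.val_one]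
    ring
  · fin_cases i <;> exact heven _
  · rw [hB]
    clear hX hY hZ hT
    fin_cases i <;> fin_cases j <;> simp [*]
  all_goals
    clear hX hY hZ hT
    fin_cases i <;> simp [*]

theorem IsReduced.exists_lieModel (hg : g.IsReduced) {α β γ : Module.Dual ℂ V}
    (hodd : ∀ x ∈ g.part 1, α x = 0 ∧ β x = 0 ∧ γ x = 0)
    (hI : ∀ x y z, g.form (g.bracket x y) z = det3 α β γ x y z) :
    ∃ m : LieModel, g.IIsomorphic m.algebra := by
  have hc : ∀ x ∈ g.part 1, x ∈ g.center := fun x hx =>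
    g.mem_center_of_form_bracket_eq_zero fun y z => by
      rw [hI, det3, (hodd x hx).1, (hodd x hx).2.1, (hodd x hx).2.2]
      ring
  -- Odd vectors are central, so they are orthogonal to each other by isotropy and to the even part
  -- by parity.
  have hp : ∀ x ∈ g.part 1, x = 0 := fun x hx => g.eq_zero_of_form_eq_zero fun y => by
    rw [g.apply_eq_evenProj_add_oddProj (g.form x) y, g.form_odd_even hx (g.evenProj_mem y),
      hg.2 x (hc x hx) _ (hc _ (g.oddProj_mem y)), add_zero]
  have heven : ∀ x, x ∈ g.part 0 := fun x => by
    rw [← g.evenProj_add_oddProj x, hp _ (g.oddProj_mem x), add_zero]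
    exact g.evenProj_mem x
  have hsym := fun x y => g.form_comm_even (heven x) (heven y)
  obtain ⟨a, rfl⟩ := g.exists_form_eq α
  obtain ⟨b, rfl⟩ := g.exists_form_eq β
  obtain ⟨c, rfl⟩ := g.exists_form_eq γ
  obtain ⟨k, u, v, w, h, hu, hv, hw⟩ := exists_isOrthogonalFactorization hsym hI
  have h' := h.rotate hsym
  have h'' := h'.rotate hsym
  -- The number of factors of length `1`, the rank of the Gram form, decides the model; the
  -- rotations bring these factors to the front.
  rcases hu with hu | hu <;> rcases hv with hv | hv <;> rcases hw with hw | hw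
  · exact ⟨.g6, h.iIsomorphic_g6 hg heven hu hv hw⟩
  · exact ⟨.g5, h''.iIsomorphic_g5 hg heven hw hu hv⟩
  · exact ⟨.g5, h'.iIsomorphic_g5 hg heven hv hw hu⟩
  · exact ⟨.g4, h'.iIsomorphic_g4 hg heven hv hw hu⟩
  · exact ⟨.g5, h.iIsomorphic_g5 hg heven hu hv hw⟩
  · exact ⟨.g4, h''.iIsomorphic_g4 hg heven hw hu hv⟩
  · exact ⟨.g4, h.iIsomorphic_g4 hg heven hu hv hw⟩
  · obtain ⟨r, hr⟩ := h.iIsomorphic_g3 hg heven hu hv hw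
    exact ⟨.g3 r, hr⟩

theorem IsReduced.exists_isModelledBy (hg : g.IsReduced) (he : g.IsElementary) :
    ∃ m, g.IsModelledBy m := by
  rcases he.homogeneous with ⟨α, β, γ, h1, h2⟩ | ⟨α, β, γ, h1, h2, h3⟩
  · obtain ⟨m, hm⟩ := hg.exists_lieModel h1 h2
    exact ⟨.inl m, hm⟩
  · obtain ⟨m, hm⟩ := hg.exists_superModel h1 h2 h3
    exact ⟨.inr m, hm⟩

end LieCase

end QuadraticLieSuperalgebra

theorem proposition3p3p3 :
    (∀ m : QuadraticLieSuperalgebra.LieModel, m.algebra.IsReduced ∧ m.algebra.IsElementary ∧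
      m.algebra.IsSingularS3 ∧ m.algebra.part 1 = ⊥) ∧
    (∀ m : QuadraticLieSuperalgebra.SuperModel, m.algebra.IsReduced ∧ m.algebra.IsElementary ∧
      Module.finrank ℂ (m.algebra.part 0) = 2) ∧
    (∀ (V : Type*) [AddCommGroup V] [Module ℂ V] [FiniteDimensional ℂ V]
      (g : QuadraticLieSuperalgebra V), g.IsReduced → g.IsElementary →
      ∃! m : QuadraticLieSuperalgebra.LieModel ⊕ QuadraticLieSuperalgebra.SuperModel,
        g.IsModelledBy m) := by
  refine ⟨fun m => m.properties, fun m => m.properties, fun V _ _ _ g hg he => ?_⟩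
  obtain ⟨m, hm⟩ := hg.exists_isModelledBy he
  exact ⟨m, hm, fun m' hm' => hm'.unique hm⟩
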